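/- Theorem. Let $Y\neq\{0\}$ be a real Banach space with the Daugavet property, i.e. $\|I+T\|=1+\|T\|$ for every bounded linear operator $T\colon Y\to Y$ of rank one. Then there are convex, closed, bounded, symmetric SCD sets $C_1,C_2\subset Y$ (symmetric meaning $-C_i=C_i$) whose Minkowski sum $C_1+C_2=\{c_1+c_2\colon c_1\in C_1,\ c_2\in C_2\}$ is not SCD. If, in addition, $Y$ is separable, then such $C_1,C_2$ can be chosen to be bodies, i.e. to have non-empty interior. Here a slice of a set $A\subset Y$ is a non-empty set of the form $S(A,y^*,\varepsilon)=\{y\in A\colon y^*(y)>\sup_{a\in A}y^*(a)-\varepsilon\}$ with $y^*\in Y^*\setminus\{0\}$ and $\varepsilon>0$. A sequence $(U_n)_{n\in\mathbb N}$ of non-empty subsets of $A$ is determining for $A$ if $A\subset\overline{\operatorname{conv}}(B)$ for every set $B\subset Y$ that intersects all the $U_n$. A set $A\subset Y$ is SCD (slicely countably determined) if it is bounded and there is a determining sequence of slices of $A$. -/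

import Mathlib

open scoped Pointwise

namespace BanachSCD

variable {X : Type*} [NormedAddCommGroup X] [NormedSpace ℝ X]

/-- The Daugavet equation `‖I + T‖ = 1 + ‖T‖`. -/
def DaugavetEquation (T : X →L[ℝ] X) : Prop :=
  ‖ContinuousLinearMap.id ℝ X + T‖ = 1 + ‖T‖

variable (X) in
/-- The Daugavet property: every bounded rank-one operator satisfies the Daugavet equation. -/
def DaugavetProperty : Prop :=
  ∀ T : X →L[ℝ] X, Module.finrank ℝ (LinearMap.range (T : X →ₗ[ℝ] X)) = 1 → DaugavetEquation T

/-- `S(A, f, ε) = {x ∈ A : f x > sup_A f - ε}`. It is only used for bounded `A`, where the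
supremum is genuine as soon as `A` is non-empty. -/
def sliceSet (A : Set X) (f : X →L[ℝ] ℝ) (ε : ℝ) : Set X :=
  {x ∈ A | sSup (f '' A) - ε < f x}

/-- `S` is a slice of `A`: a non-empty set `S(A, f, ε)` with `f ≠ 0` and `ε > 0`. -/
def IsSlice (A S : Set X) : Prop :=
  S.Nonempty ∧ ∃ f : X →L[ℝ] ℝ, f ≠ 0 ∧ ∃ ε : ℝ, 0 < ε ∧ S = sliceSet A f ε

/-- A sequence of non-empty subsets of `A` is determining for `A` if the closed convex hull of
every set that meets all of them contains `A`. -/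
def IsDetermining (A : Set X) (U : ℕ → Set X) : Prop :=
  (∀ n, (U n).Nonempty ∧ U n ⊆ A) ∧
    ∀ B : Set X, (∀ n, (B ∩ U n).Nonempty) → A ⊆ closure (convexHull ℝ B)

/-- `A` is slicely countably determined: it is bounded and has a determining sequence of
slices. -/
def IsSCD (A : Set X) : Prop :=
  Bornology.IsBounded A ∧ ∃ U : ℕ → Set X, (∀ n, IsSlice A (U n)) ∧ IsDetermining A U

end BanachSCD

namespace BanachSCD

/-! Let `g` be a functional of norm one attained at a unit vector `e`. Its kernel inherits the slice
form of the Daugavet property (`DaugavetSlices.ker`). Let Z be this kernel if Y is separable, and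
otherwise a separable closed subspace of it with the same property
(`DaugavetSlices.exists_separable_subspace`). Then Z × ℝ embeds in Y along `e`, onto Y in the
separable case, so it suffices to work in Z × ℝ with the maximum norm.

Both sets lie between the balls of radius 1 and 3/2. Each is the closed convex hull of countably
many strongly exposed points, hence SCD (`isSCD_of_strongly_exposed`): the equivalent norms ‖·‖ + μN
strongly expose a dense set of directions of Z, and a strictly convex curve of weights (α, β)
tending to (1, 1) separates the levels. The two curves are mirror images, so that a functional (h,
s) is bounded by ‖h‖ + |s|, its supremum over the unit ball, on the first set if |s| ≤ ‖h‖ and on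
the second if |s| ≥ ‖h‖.

Hence every slice of the sum contains a translate, by a vector of norm at most 3/2, of a slice of
the unit ball. From these ball slices the Daugavet property picks points any finitely many of which
are sent close to -1 by a norm-one functional that is close to 1 at a unit vector y. After
translation the values stay near 1/2 or below, while the point 2(y, 0) of the sum has value near 2.
No sequence of slices is therefore determining (`DaugavetSlices.exists_not_mem_closure`). -/

/-- For every point `x`, every slice of the unit ball contains elements `b` such that
`‖x + b‖` is almost as large as possible. -/
def DaugavetSlices (Z : Type*) [NormedAddCommGroup Z] [NormedSpace ℝ Z] : Prop :=
  ∀ (x : Z) (h : Z →L[ℝ] ℝ) (ε : ℝ), 0 < ε →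
    ∃ b : Z, ‖b‖ ≤ 1 ∧ ‖h‖ - ε < h b ∧ ‖x‖ + 1 - ε < ‖x + b‖

/-! ### The Daugavet property through slices, and its passage to hyperplanes. -/

section Normed

variable {Z : Type*} [NormedAddCommGroup Z] [NormedSpace ℝ Z]

theorem exists_norm_lt_one_lt_norm_apply {F : Type*} [NormedAddCommGroup F] [NormedSpace ℝ F]
    (T : Z →L[ℝ] F) {r : ℝ} (hr : r < ‖T‖) : ∃ y : Z, ‖y‖ < 1 ∧ r < ‖T y‖ := by
  obtain ⟨y, hy, hr⟩ := T.exists_lt_apply_of_lt_opNorm hr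
  exact ⟨y, hy, hr⟩

theorem exists_norm_lt_one_lt_apply (h : Z →L[ℝ] ℝ) {r : ℝ} (hr : r < ‖h‖) :
    ∃ y : Z, ‖y‖ < 1 ∧ r < h y := by
  obtain ⟨y, hy, hr⟩ := exists_norm_lt_one_lt_norm_apply h hr
  rcases le_total 0 (h y) with h0 | h0
  · exact ⟨y, hy, by rwa [Real.norm_of_nonneg h0] at hr⟩
  · exact ⟨-y, by rwa [norm_neg], by rwa [Real.norm_of_nonpos h0, ← map_neg] at hr⟩

theorem apply_le_norm_of_norm_le_one (h : Z →L[ℝ] ℝ) {y : Z} (hy : ‖y‖ ≤ 1) : h y ≤ ‖h‖ :=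
  (le_abs_self _).trans ((h.le_opNorm y).trans (mul_le_of_le_one_right (norm_nonneg _) hy))

theorem apply_le_norm_of_opNorm_le_one {h : Z →L[ℝ] ℝ} (hh : ‖h‖ ≤ 1) (y : Z) : h y ≤ ‖y‖ :=
  (le_abs_self _).trans ((h.le_opNorm y).trans (mul_le_of_le_one_left (norm_nonneg _) hh))

/-- Apply the Daugavet equation to z ↦ f(z)x with f = h/‖h‖. If y almost attains the norm 1 + ‖x‖
and f(y) ≥ 0, then f(y) must be close to 1, so y lies in the slice and y + f(y)x is close to x + y.
-/
theorem DaugavetProperty.exists_of_ne_zero (hZ : DaugavetProperty Z) {x : Z} (hx : x ≠ 0)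
    {h : Z →L[ℝ] ℝ} (hh : h ≠ 0) {ε : ℝ} (hε : 0 < ε) :
    ∃ b : Z, ‖b‖ ≤ 1 ∧ ‖h‖ - ε < h b ∧ ‖x‖ + 1 - ε < ‖x + b‖ := by
  have hx' : 0 < ‖x‖ := norm_pos_iff.2 hx
  have hh' : 0 < ‖h‖ := norm_pos_iff.2 hh
  set f : Z →L[ℝ] ℝ := ‖h‖⁻¹ • h with hf
  have hfn : ‖f‖ = 1 := by rw [hf, norm_smul, norm_inv, norm_norm, inv_mul_cancel₀ hh'.ne']
  have hf0 : (f : Z →ₗ[ℝ] ℝ) ≠ 0 := by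
    intro h0
    have : f = 0 := by ext z; exact LinearMap.congr_fun h0 z
    simp [this] at hfn
  have hT : Module.finrank ℝ (LinearMap.range ((f.smulRight x : Z →L[ℝ] Z) : Z →ₗ[ℝ] Z)) = 1 := by
    have : ((f.smulRight x : Z →L[ℝ] Z) : Z →ₗ[ℝ] Z) = (f : Z →ₗ[ℝ] ℝ).smulRight x := rfl
    rw [this, LinearMap.range_smulRight_apply hf0]
    exact finrank_span_singleton hx
  have hD := hZ _ hT
  rw [DaugavetEquation, ContinuousLinearMap.norm_smulRight_apply, hfn, one_mul] at hD
  obtain ⟨δ, hδ0, hδ1, hδ2⟩ : ∃ δ : ℝ, 0 < δ ∧ 2 * δ ≤ ε ∧ ‖h‖ * δ ≤ ε * ‖x‖ := by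
    refine ⟨min (ε / 2) (ε * ‖x‖ / ‖h‖), by positivity, ?_, ?_⟩
    · linarith [min_le_left (ε / 2) (ε * ‖x‖ / ‖h‖)]
    · calc ‖h‖ * _ ≤ ‖h‖ * (ε * ‖x‖ / ‖h‖) := by gcongr; exact min_le_right _ _
        _ = _ := by field_simp
  obtain ⟨y, hy, hyT, hy0⟩ : ∃ y : Z, ‖y‖ ≤ 1 ∧ 1 + ‖x‖ - δ < ‖y + f y • x‖ ∧ 0 ≤ f y := by
    obtain ⟨y, hy, hyT⟩ := exists_norm_lt_one_lt_norm_apply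
      (ContinuousLinearMap.id ℝ Z + f.smulRight x) (r := 1 + ‖x‖ - δ) (by linarith)
    simp only [_root_.add_apply, ContinuousLinearMap.id_apply,
      ContinuousLinearMap.smulRight_apply] at hyT
    rcases le_total 0 (f y) with h0 | h0
    · exact ⟨y, hy.le, hyT, h0⟩
    · refine ⟨-y, by rw [norm_neg]; exact hy.le, ?_, by simpa using h0⟩
      rwa [map_neg, neg_smul, ← neg_add, norm_neg]
  have h1 : ‖y + f y • x‖ ≤ 1 + f y * ‖x‖ := by
    refine (norm_add_le _ _).trans (add_le_add hy ?_)
    rw [norm_smul, Real.norm_of_nonneg hy0]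
  have hfy : f y ≤ 1 := hfn ▸ apply_le_norm_of_norm_le_one f hy
  have hhf : h y = ‖h‖ * f y := by
    rw [hf, _root_.smul_apply, smul_eq_mul, mul_inv_cancel_left₀ hh'.ne']
  refine ⟨y, hy, ?_, ?_⟩
  · rw [hhf]
    have h2 : ‖h‖ * (‖x‖ * (1 - f y)) < ‖h‖ * δ := by
      apply mul_lt_mul_of_pos_left _ hh'
      linarith
    have h3 : ‖x‖ * (‖h‖ * (1 - f y)) < ‖x‖ * ε := by linarith
    have := lt_of_mul_lt_mul_left h3 hx'.le
    linarith
  · have h2 : ‖y + f y • x‖ ≤ ‖x + y‖ + (1 - f y) * ‖x‖ := by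
      have : y + f y • x = (x + y) - (1 - f y) • x := by rw [sub_smul, one_smul]; abel
      rw [this]
      refine (norm_sub_le _ _).trans (add_le_add le_rfl ?_)
      rw [norm_smul, Real.norm_of_nonneg (by linarith)]
    linarith

theorem DaugavetProperty.daugavetSlices [Nontrivial Z] (hZ : DaugavetProperty Z) :
    DaugavetSlices Z := by
  obtain ⟨x₀, hx₀⟩ := exists_norm_eq Z zero_le_one
  have hx₀' : x₀ ≠ 0 := norm_ne_zero_iff.1 (by rw [hx₀]; exact one_ne_zero)
  have key : ∀ (x : Z) (h : Z →L[ℝ] ℝ) (ε : ℝ), 0 < ε → x ≠ 0 →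
      ∃ b : Z, ‖b‖ ≤ 1 ∧ ‖h‖ - ε < h b ∧ ‖x‖ + 1 - ε < ‖x + b‖ := by
    intro x h ε hε hx
    rcases eq_or_ne h 0 with rfl | hh
    · obtain ⟨g, hg, -⟩ := exists_dual_vector' ℝ x₀
      have hg0 : g ≠ 0 := norm_ne_zero_iff.1 (by rw [hg]; exact one_ne_zero)
      obtain ⟨b, hb, -, hb'⟩ := hZ.exists_of_ne_zero hx hg0 hε
      exact ⟨b, hb, by simpa using hε, hb'⟩
    · exact hZ.exists_of_ne_zero hx hh hε
  intro x h ε hε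
  rcases eq_or_ne x 0 with rfl | hx
  · obtain ⟨b, hb, hb1, hb2⟩ := key x₀ h ε hε hx₀'
    refine ⟨b, hb, hb1, ?_⟩
    have := norm_add_le x₀ b
    rw [norm_zero, zero_add, zero_add]
    linarith
  · exact key x h ε hε hx

theorem daugavetSlices_of_approx
    (H : ∀ (x : Z) (h : Z →L[ℝ] ℝ) (ε : ℝ), 0 < ε →
      ∃ b : Z, ‖b‖ ≤ 1 + ε ∧ ‖h‖ - ε < h b ∧ ‖x‖ + 1 - ε < ‖x + b‖) : DaugavetSlices Z := by
  intro x h ε hε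
  obtain ⟨δ, hδ0, hδ1, hδ2⟩ : ∃ δ : ℝ, 0 < δ ∧ 2 * δ ≤ ε ∧ δ * (‖h‖ + 1) ≤ ε := by
    refine ⟨min (ε / 2) (ε / (‖h‖ + 1)), by positivity, ?_, ?_⟩
    · linarith [min_le_left (ε / 2) (ε / (‖h‖ + 1))]
    · calc _ ≤ ε / (‖h‖ + 1) * (‖h‖ + 1) := by gcongr; exact min_le_right _ _
        _ = _ := by field_simp
  obtain ⟨b, hb, hb1, hb2⟩ := H x h δ hδ0
  have hd : ‖b - (1 + δ)⁻¹ • b‖ ≤ δ := by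
    have : b - (1 + δ)⁻¹ • b = (δ * (1 + δ)⁻¹) • b := by
      have : δ * (1 + δ)⁻¹ = 1 - (1 + δ)⁻¹ := by field_simp; ring
      rw [this, sub_smul, one_smul]
    rw [this, norm_smul, Real.norm_of_nonneg (by positivity), mul_assoc]
    have : (1 + δ)⁻¹ * ‖b‖ ≤ 1 := by
      rw [inv_mul_le_iff₀ (by positivity)]; linarith
    nlinarith
  refine ⟨(1 + δ)⁻¹ • b, ?_, ?_, ?_⟩
  · rw [norm_smul, norm_inv, Real.norm_of_nonneg (by positivity : (0 : ℝ) ≤ 1 + δ),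
      inv_mul_le_iff₀ (by positivity)]
    linarith
  · have h1 : h (b - (1 + δ)⁻¹ • b) ≤ ‖h‖ * δ :=
      (le_abs_self _).trans ((h.le_opNorm _).trans (by gcongr))
    rw [map_sub] at h1
    linarith
  · have : x + b = (x + (1 + δ)⁻¹ • b) + (b - (1 + δ)⁻¹ • b) := by abel
    have h2 := norm_add_le (x + (1 + δ)⁻¹ • b) (b - (1 + δ)⁻¹ • b)
    rw [← this] at h2
    linarith

/-- Two points are taken from slices of h ± τg, one after the other, so that x + y₁ + y₂ has norm
almost ‖x‖ + 2. A functional norming this sum almost norms all three terms, so every convex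
combination of y₁ and y₂ satisfies the norm estimate; one of them almost lies in ker g. -/
theorem DaugavetSlices.exists_ker (hZ : DaugavetSlices Z) (x : Z) (h g : Z →L[ℝ] ℝ)
    {m : ℝ} (hm : ‖h‖ ≤ m) (hmg : ∀ τ : ℝ, m ≤ ‖h + τ • g‖) {ε : ℝ} (hε : 0 < ε) :
    ∃ y : Z, ‖y‖ ≤ 1 ∧ m - ε < h y ∧ ‖x‖ + 1 - ε < ‖x + y‖ ∧ |g y| ≤ ε := by
  obtain ⟨τ, hτ0, hτ1, hτ2, hτ3⟩ : ∃ τ : ℝ, 0 < τ ∧ 4 * τ ≤ ε ∧ τ ≤ 1 ∧ 4 * τ * ‖g‖ ≤ ε := by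
    refine ⟨min (min (ε / 4) 1) (ε / (4 * (‖g‖ + 1))), by positivity, ?_, ?_, ?_⟩
    · linarith [min_le_left (min (ε / 4) 1) (ε / (4 * (‖g‖ + 1))), min_le_left (ε / 4) 1]
    · linarith [min_le_left (min (ε / 4) 1) (ε / (4 * (‖g‖ + 1))), min_le_right (ε / 4) 1]
    · calc _ ≤ 4 * (ε / (4 * (‖g‖ + 1))) * (‖g‖ + 1) := by
            gcongr
            · exact min_le_right _ _
            · linarith
        _ = ε := by field_simp
  have hτε : τ ^ 2 ≤ τ := by nlinarith
  -- The tolerance τ² is divided by τ below: h(y₁) ≤ m and h(y₁) + τ g(y₁) > m - τ² give g(y₁) ≥ -τ,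
  -- and symmetrically g(y₂) ≤ τ.
  obtain ⟨y₁, hy₁, hy₁h, hy₁n⟩ := hZ x (h + τ • g) (τ ^ 2) (by positivity)
  obtain ⟨y₂, hy₂, hy₂h, hy₂n⟩ := hZ (x + y₁) (h + (-τ) • g) (τ ^ 2) (by positivity)
  have hm₁ := hmg τ
  have hm₂ := hmg (-τ)
  simp only [_root_.add_apply, _root_.smul_apply, smul_eq_mul]
    at hy₁h hy₂h
  have hh₁ := (apply_le_norm_of_norm_le_one h hy₁).trans hm
  have hh₂ := (apply_le_norm_of_norm_le_one h hy₂).trans hm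
  have hg₁ : -τ ≤ g y₁ := by nlinarith
  have hg₂ : g y₂ ≤ τ := by nlinarith
  have hgn₁ := apply_le_norm_of_norm_le_one g hy₁
  have hgn₂ : -(g y₂) ≤ ‖g‖ := by
    rw [← map_neg]; exact apply_le_norm_of_norm_le_one g (by rwa [norm_neg])
  have hhy₁ : m - ε < h y₁ := by nlinarith
  have hhy₂ : m - ε < h y₂ := by nlinarith
  obtain ⟨φ, hφ, hφx⟩ := exists_dual_vector'' ℝ (x + y₁ + y₂)
  simp only [map_add, RCLike.ofReal_real_eq_id, id_eq] at hφx
  have hφ0 := apply_le_norm_of_opNorm_le_one hφ x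
  have hφ1 := (apply_le_norm_of_opNorm_le_one hφ y₁).trans hy₁
  have hφ2 := (apply_le_norm_of_opNorm_le_one hφ y₂).trans hy₂
  obtain ⟨l, l', hl, hl', hll, hgl⟩ : ∃ l l' : ℝ, 0 ≤ l ∧ 0 ≤ l' ∧ l + l' = 1 ∧
      |l * g y₁ + l' * g y₂| ≤ ε := by
    by_cases c₁ : g y₁ ≤ τ
    · exact ⟨1, 0, by norm_num, by norm_num, by norm_num, by
        rw [abs_le]; constructor <;> linarith⟩
    by_cases c₂ : -τ ≤ g y₂
    · exact ⟨0, 1, by norm_num, by norm_num, by norm_num, by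
        rw [abs_le]; constructor <;> linarith⟩
    push Not at c₁ c₂
    have hp : 0 < g y₁ - g y₂ := by linarith
    refine ⟨-(g y₂) / (g y₁ - g y₂), g y₁ / (g y₁ - g y₂), div_nonneg (by linarith) hp.le,
      div_nonneg (by linarith) hp.le, by field_simp; ring, ?_⟩
    have : -(g y₂) / (g y₁ - g y₂) * g y₁ + g y₁ / (g y₁ - g y₂) * g y₂ = 0 := by
      field_simp; ring
    rw [this, abs_zero]; exact hε.le
  refine ⟨l • y₁ + l' • y₂, ?_, ?_, ?_, ?_⟩
  · have := (convex_closedBall (0 : Z) 1) (by simpa using hy₁) (by simpa using hy₂) hl hl' hll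
    simpa using this
  · rw [map_add, map_smul, map_smul]
    exact (convex_Ioi (m - ε)) hhy₁ hhy₂ hl hl' hll
  · have h1 := apply_le_norm_of_opNorm_le_one hφ (x + (l • y₁ + l' • y₂))
    simp only [map_add, map_smul, smul_eq_mul] at h1
    nlinarith
  · simpa only [map_add, map_smul, smul_eq_mul] using hgl

theorem DaugavetSlices.ker (hZ : DaugavetSlices Z) (g : Z →L[ℝ] ℝ) {e : Z} (he : g e = 1) :
    DaugavetSlices (LinearMap.ker (g : Z →ₗ[ℝ] ℝ)) := by
  apply daugavetSlices_of_approx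
  intro x h ε hε
  obtain ⟨H, hH, hHn⟩ := exists_extension_norm_eq (LinearMap.ker (g : Z →ₗ[ℝ] ℝ)) h
  -- Adding a multiple of `g` does not change the restriction to the kernel.
  have hmg : ∀ τ : ℝ, ‖h‖ ≤ ‖H + τ • g‖ := by
    intro τ
    apply h.opNorm_le_bound (norm_nonneg _)
    intro z
    have hz : g z = 0 := z.2
    have := (H + τ • g).le_opNorm z
    simpa [hz, hH] using this
  obtain ⟨δ, hδ0, hδ1, hδ2, hδ3⟩ : ∃ δ : ℝ, 0 < δ ∧ 2 * δ ≤ ε ∧ 2 * (δ * ‖e‖) ≤ ε ∧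
      2 * (‖h‖ * (δ * ‖e‖)) ≤ ε := by
    have hp : 0 < 2 * (1 + ‖e‖ + ‖h‖ * ‖e‖) := by positivity
    refine ⟨ε / (2 * (1 + ‖e‖ + ‖h‖ * ‖e‖)), by positivity, ?_, ?_, ?_⟩
    all_goals
      rw [← sub_nonneg]
      field_simp
      nlinarith [norm_nonneg e, norm_nonneg h, mul_nonneg (norm_nonneg h) (norm_nonneg e)]
  obtain ⟨y, hy, hyh, hyn, hyg⟩ := hZ.exists_ker (x : Z) H g hHn.le hmg hδ0
  have hge : ‖g y • e‖ ≤ δ * ‖e‖ := by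
    rw [norm_smul]; gcongr; exact hyg
  refine ⟨⟨y - g y • e, by simp [he]⟩, ?_, ?_, ?_⟩
  · rw [Submodule.coe_norm]
    have := norm_sub_le y (g y • e)
    simp only
    linarith
  · rw [← hH]
    simp only [map_sub]
    have : H (g y • e) ≤ ‖h‖ * (δ * ‖e‖) := by
      rw [← hHn]
      exact (le_abs_self _).trans ((H.le_opNorm _).trans (by gcongr))
    linarith
  · rw [Submodule.coe_norm, Submodule.coe_norm, Submodule.coe_add]
    have h1 : (x : Z) + y = (x + (y - g y • e)) + g y • e := by abel
    have h2 := norm_add_le ((x : Z) + (y - g y • e)) (g y • e)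
    rw [← h1] at h2
    simp only
    linarith

/-- On the line spanned by e, a point of the ball with g < -1/2 is close to -e, so its sum with e is
short. -/
theorem DaugavetSlices.nontrivial_ker (hZ : DaugavetSlices Z) (g : Z →L[ℝ] ℝ) (hg : ‖g‖ = 1)
    {e : Z} (he : g e = 1) (hen : ‖e‖ = 1) :
    Nontrivial (LinearMap.ker (g : Z →ₗ[ℝ] ℝ)) := by
  obtain ⟨b, hb, hgb, hbn⟩ := hZ e (-g) (1 / 2) (by norm_num)
  simp only [norm_neg, hg, _root_.neg_apply, hen] at hgb hbn
  refine ⟨⟨b - g b • e, by simp [he]⟩, 0, fun h0 => ?_⟩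
  have h1 : b = g b • e := by
    rw [← sub_eq_zero]; exact congrArg Subtype.val h0
  have h2 : e + b = (1 + g b) • e := by
    rw [add_smul, one_smul, ← h1]
  have h3 : -1 ≤ g b := by
    have := apply_le_norm_of_norm_le_one g (y := -b) (by rwa [norm_neg])
    rw [hg, map_neg] at this
    linarith
  rw [h2, norm_smul, hen, mul_one, Real.norm_eq_abs] at hbn
  rw [lt_abs] at hbn
  rcases hbn with h | h <;> linarith

end Normed

/-! ### Reduction to a separable subspace. -/

theorem exists_countable_superset_closed {α : Type*} (G : α → α → Set α)
    (hG : ∀ x y, (G x y).Countable) {D₀ : Set α} (hD₀ : D₀.Countable) :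
    ∃ D : Set α, D₀ ⊆ D ∧ D.Countable ∧ ∀ x ∈ D, ∀ y ∈ D, G x y ⊆ D := by
  let step : Set α → Set α := fun D => D ∪ ⋃ x ∈ D, ⋃ y ∈ D, G x y
  let E : ℕ → Set α := fun n => step^[n] D₀
  have hE : ∀ n, E (n + 1) = step (E n) := fun n => Function.iterate_succ_apply' _ _ _
  have hmono : Monotone E := monotone_nat_of_le_succ fun n => by
    rw [hE]; exact Set.subset_union_left
  refine ⟨⋃ n, E n, Set.subset_iUnion E 0, Set.countable_iUnion fun n => ?_, ?_⟩
  · induction n with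
    | zero => exact hD₀
    | succ n ih =>
      rw [hE]
      exact ih.union (ih.biUnion fun x _ => ih.biUnion fun y _ => hG x y)
  · intro x hx y hy z hz
    obtain ⟨m, hm⟩ := Set.mem_iUnion.1 hx
    obtain ⟨n, hn⟩ := Set.mem_iUnion.1 hy
    refine Set.mem_iUnion.2 ⟨max m n + 1, ?_⟩
    rw [hE]
    refine Or.inr (Set.mem_biUnion (hmono (le_max_left m n) hm) ?_)
    exact Set.mem_biUnion (hmono (le_max_right m n) hn) hz

section Normed

variable {K : Type*} [NormedAddCommGroup K] [NormedSpace ℝ K]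

/-- Hahn–Banach trades the functionals for convex combinations. Finite witnesses can be collected in
a countable set, whereas the functionals on a subspace cannot be enumerated. -/
theorem DaugavetSlices.exists_finset (hK : DaugavetSlices K) (x : K) {y : K} (hy : ‖y‖ ≤ 1)
    {ε : ℝ} (hε : 0 < ε) :
    ∃ t : Finset K, (∀ b ∈ t, ‖b‖ ≤ 1 ∧ ‖x‖ + 1 - ε < ‖x + b‖) ∧
      ∃ v ∈ convexHull ℝ (t : Set K), ‖v - y‖ < ε := by
  set S : Set K := {b | ‖b‖ ≤ 1 ∧ ‖x‖ + 1 - ε < ‖x + b‖} with hS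
  have hmem : y ∈ closure (convexHull ℝ S) := by
    by_contra hy'
    obtain ⟨h, u, hu, huy⟩ := geometric_hahn_banach_closed_point
      (convex_convexHull ℝ S).closure isClosed_closure hy'
    obtain ⟨b, hb, hhb, hxb⟩ := hK x h (min ε (h y - u)) (lt_min hε (by linarith))
    have hbS : b ∈ S := ⟨hb, by linarith [min_le_left ε (h y - u)]⟩
    have := hu b (subset_closure (subset_convexHull ℝ S hbS))
    linarith [min_le_right ε (h y - u), apply_le_norm_of_norm_le_one h hy]
  obtain ⟨v, hv, hvy⟩ := Metric.mem_closure_iff.1 hmem ε hε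
  rw [convexHull_eq_union_convexHull_finite_subsets] at hv
  simp only [Set.mem_iUnion] at hv
  obtain ⟨t, ht, hvt⟩ := hv
  exact ⟨t, fun b hb => ht hb, v, hvt, by rwa [dist_comm, dist_eq_norm] at hvy⟩

/-- The closure of a set closed under addition and rational multiples, as a real subspace. -/
def closureSubmodule (D : Set K) (h0 : (0 : K) ∈ D) (hadd : ∀ x ∈ D, ∀ y ∈ D, x + y ∈ D)
    (hsmul : ∀ q : ℚ, ∀ x ∈ D, (q : ℝ) • x ∈ D) : Submodule ℝ K where
  carrier := closure D
  zero_mem' := subset_closure h0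
  add_mem' := fun {_ _} ha hb => map_mem_closure₂ continuous_add ha hb hadd
  smul_mem' := fun c _ hx => by
    have hc : c ∈ closure (Set.range ((↑) : ℚ → ℝ)) := Rat.denseRange_cast c
    refine map_mem_closure₂ continuous_smul hc hx ?_
    rintro _ ⟨q, rfl⟩ y hy
    exact hsmul q y hy

theorem DaugavetSlices.exists_separable_subspace [Nontrivial K] (hK : DaugavetSlices K) :
    ∃ Z : Submodule ℝ K, IsClosed (Z : Set K) ∧ TopologicalSpace.SeparableSpace Z ∧
      Nontrivial Z ∧ DaugavetSlices Z := by
  have hF : ∀ (x y : K) (n : ℕ), ∃ t : Finset K, ‖y‖ ≤ 1 →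
      (∀ b ∈ t, ‖b‖ ≤ 1 ∧ ‖x‖ + 1 - 1 / ((n : ℝ) + 1) < ‖x + b‖) ∧
      ∃ v ∈ convexHull ℝ (t : Set K), ‖v - y‖ < 1 / ((n : ℝ) + 1) := by
    intro x y n
    by_cases hy : ‖y‖ ≤ 1
    · obtain ⟨t, ht⟩ := hK.exists_finset x hy (Nat.one_div_pos_of_nat (n := n))
      exact ⟨t, fun _ => ht⟩
    · exact ⟨∅, fun h => absurd h hy⟩
  choose F hF using hF
  obtain ⟨w, hw⟩ := exists_ne (0 : K)
  obtain ⟨D, hD₀, hDc, hD⟩ := exists_countable_superset_closed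
    (fun x y : K => {x + y} ∪ Set.range (fun q : ℚ => (q : ℝ) • x) ∪ ⋃ n, (F x y n : Set K))
    (fun x y => ((Set.countable_singleton _).union (Set.countable_range _)).union
      (Set.countable_iUnion fun n => (F x y n).countable_toSet))
    (Set.countable_singleton w)
  have hwD : w ∈ D := hD₀ rfl
  have hadd : ∀ x ∈ D, ∀ y ∈ D, x + y ∈ D := fun x hx y hy =>
    hD x hx y hy (Or.inl (Or.inl rfl))
  have hsmul : ∀ q : ℚ, ∀ x ∈ D, (q : ℝ) • x ∈ D := fun q x hx =>
    hD x hx x hx (Or.inl (Or.inr ⟨q, rfl⟩))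
  have h0 : (0 : K) ∈ D := by simpa using hsmul 0 w hwD
  have hFD : ∀ x ∈ D, ∀ y ∈ D, ∀ n, (F x y n : Set K) ⊆ D := fun x hx y hy n =>
    (Set.subset_iUnion (fun n => (F x y n : Set K)) n).trans
      (Set.subset_union_right.trans (hD x hx y hy))
  let Z := closureSubmodule D h0 hadd hsmul
  have hZ : (Z : Set K) = closure D := rfl
  have hDZ : D ⊆ Z := subset_closure
  refine ⟨Z, isClosed_closure, ?_, ⟨⟨w, hDZ hwD⟩, 0, fun h => hw (congrArg Subtype.val h)⟩, ?_⟩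
  · exact (hDc.isSeparable.closure).separableSpace
  intro x h ε hε
  obtain ⟨H, hH, hHn⟩ := exists_extension_norm_eq Z h
  obtain ⟨x', hx'D, hxx'⟩ := Metric.mem_closure_iff.1 x.2 (ε / 4) (by positivity)
  rw [dist_eq_norm] at hxx'
  obtain ⟨y, hyD, hy, hHy⟩ : ∃ y ∈ D, ‖y‖ ≤ 1 ∧ ‖h‖ - ε / 2 < H y := by
    obtain ⟨z, hz, hhz⟩ := exists_norm_lt_one_lt_apply h (r := ‖h‖ - ε / 2) (by linarith)
    have hopen : IsOpen {y : K | ‖y‖ < 1 ∧ ‖h‖ - ε / 2 < H y} :=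
      (isOpen_lt continuous_norm continuous_const).inter (isOpen_lt continuous_const H.continuous)
    obtain ⟨y, hy, hyD⟩ := mem_closure_iff.1 z.2 _ hopen ⟨hz, by rw [hH]; exact hhz⟩
    exact ⟨y, hyD, hy.1.le, hy.2⟩
  obtain ⟨n, hn⟩ := exists_nat_one_div_lt (show 0 < ε / (2 * (‖h‖ + 1)) by positivity)
  have hn1 : ‖h‖ * (1 / ((n : ℝ) + 1)) ≤ ε / 2 := by
    calc _ ≤ (‖h‖ + 1) * (ε / (2 * (‖h‖ + 1))) := by gcongr; linarith
      _ = ε / 2 := by field_simp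
  have hn2 : 1 / ((n : ℝ) + 1) ≤ ε / 2 := by
    refine hn.le.trans ?_
    rw [div_le_div_iff₀ (by positivity) (by norm_num)]
    nlinarith [norm_nonneg h]
  obtain ⟨ht, v, hv, hvy⟩ := hF x' y n hy
  -- The value of `H` at a convex combination is at most its largest value at the points combined.
  obtain ⟨b, hb, hvb⟩ := (H.toLinearMap.convexOn convex_univ).exists_ge_of_mem_convexHull
    (Set.subset_univ _) hv
  obtain ⟨hb1, hb2⟩ := ht b hb
  refine ⟨⟨b, hDZ (hFD x' hx'D y hyD n hb)⟩, hb1, ?_, ?_⟩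
  · rw [← hH]
    have h1 : H (y - v) ≤ ‖h‖ * (1 / ((n : ℝ) + 1)) := by
      rw [← hHn]
      refine (le_abs_self _).trans ((H.le_opNorm _).trans ?_)
      rw [norm_sub_rev]; gcongr
    rw [map_sub] at h1
    have hvb' : H v ≤ H b := hvb
    simp only
    linarith
  · rw [Submodule.coe_norm, Submodule.coe_norm, Submodule.coe_add]
    have h1 : ‖(x : K)‖ ≤ ‖x'‖ + ‖(x : K) - x'‖ := by
      simpa using norm_add_le x' ((x : K) - x')
    have h2 : ‖x' + b‖ ≤ ‖(x : K) + b‖ + ‖(x : K) - x'‖ := by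
      have : x' + b = (x + b) - (x - x') := by abel
      rw [this]; exact norm_sub_le _ _
    simp only
    linarith

end Normed

/-! ### Renormings with prescribed strongly exposed points. -/

section Normed

variable {Z : Type*} [NormedAddCommGroup Z] [NormedSpace ℝ Z]

/-- A weighted sum of uniformly bounded seminorms, from which each summand can be split off. -/
theorem exists_seminorm_split (q : ℕ → Seminorm ℝ Z) (hq : ∀ n z, q n z ≤ 2 * ‖z‖) :
    ∃ N : Seminorm ℝ Z, (∀ z, N z ≤ ‖z‖) ∧
      ∀ n, ∃ c : ℝ, 0 < c ∧ ∃ p : Seminorm ℝ Z, ∀ z, N z = c * q n z + p z := by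
  have hgeo : Summable fun n : ℕ => (1 / 4 : ℝ) * (1 / 2) ^ n :=
    summable_geometric_two.mul_left _
  have hsum : ∀ w : ℕ → ℝ, (∀ n, 0 ≤ w n) → (∀ n, w n ≤ 1 / 4 * (1 / 2) ^ n) → ∀ z,
      Summable fun n => w n * q n z := by
    intro w hw0 hw z
    refine Summable.of_nonneg_of_le (fun n => mul_nonneg (hw0 n) (apply_nonneg _ _))
      (fun n => ?_) (hgeo.mul_right (2 * ‖z‖))
    exact mul_le_mul (hw n) (hq n z) (apply_nonneg _ _) (by positivity)
  have hex : ∀ w : ℕ → ℝ, (∀ n, 0 ≤ w n) → (∀ n, w n ≤ 1 / 4 * (1 / 2) ^ n) →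
      ∃ N : Seminorm ℝ Z, ∀ z, N z = ∑' n, w n * q n z := by
    intro w hw0 hw
    refine ⟨Seminorm.of (fun z => ∑' n, w n * q n z) (fun x y => ?_) (fun a x => ?_),
      fun z => rfl⟩
    · rw [← (hsum w hw0 hw x).tsum_add (hsum w hw0 hw y)]
      refine (hsum w hw0 hw _).tsum_le_tsum (fun n => ?_)
        ((hsum w hw0 hw x).add (hsum w hw0 hw y))
      rw [← mul_add]
      exact mul_le_mul_of_nonneg_left (map_add_le_add _ _ _) (hw0 n)
    · rw [← tsum_mul_left]
      congr 1; ext n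
      rw [map_smul_eq_mul]; ring
  -- The weights sum to 1/2, which compensates the factor 2 in `hq`.
  have hW0 : ∀ n : ℕ, (0 : ℝ) ≤ 1 / 4 * (1 / 2) ^ n := fun n => by positivity
  obtain ⟨N, hN⟩ := hex _ hW0 fun n => le_rfl
  refine ⟨N, fun z => ?_, fun n => ⟨1 / 4 * (1 / 2) ^ n, by positivity, ?_⟩⟩
  · rw [hN]
    calc _ ≤ ∑' n : ℕ, 1 / 4 * (1 / 2 : ℝ) ^ n * (2 * ‖z‖) :=
          (hsum _ hW0 (fun n => le_rfl) z).tsum_le_tsum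
            (fun n => mul_le_mul_of_nonneg_left (hq n z) (hW0 n)) (hgeo.mul_right _)
      _ = ‖z‖ := by rw [tsum_mul_right, tsum_mul_left, tsum_geometric_two]; ring
  · obtain ⟨p, hp⟩ := hex (fun m => if m = n then 0 else 1 / 4 * (1 / 2) ^ m)
      (fun m => by split_ifs; exacts [le_rfl, hW0 m])
      (fun m => by split_ifs; exacts [hW0 m, le_rfl])
    refine ⟨p, fun z => ?_⟩
    rw [hN, hp, (hsum _ hW0 (fun n => le_rfl) z).tsum_eq_add_tsum_ite n]
    congr 2; ext m
    split_ifs <;> simp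

theorem exists_dual_le_seminorm {p : Seminorm ℝ Z} (hp : Continuous p) {x : Z} (hx : x ≠ 0) :
    ∃ h : Z →L[ℝ] ℝ, h x = p x ∧ ∀ z, |h z| ≤ p z := by
  let f := LinearPMap.mkSpanSingleton (σ := RingHom.id ℝ) x (p x) hx
  obtain ⟨g, hg, hgp⟩ := Module.Dual.exists_continuous_extension_of_le_seminorm_real
    f.domain f.toFun hp (by
      rintro ⟨y, hy⟩
      obtain ⟨c, rfl⟩ := Submodule.mem_span_singleton.1 hy
      have : f ⟨c • x, hy⟩ = c * p x := LinearPMap.mkSpanSingleton'_apply _ _ _ _ _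
      change f ⟨c • x, hy⟩ ≤ p (c • x)
      rw [this, map_smul_eq_mul]
      exact mul_le_mul_of_nonneg_right (le_abs_self c) (apply_nonneg _ _))
  refine ⟨g, ?_, hgp⟩
  have hx' : x ∈ f.domain := Submodule.mem_span_singleton_self x
  have : f ⟨x, hx'⟩ = p x := LinearPMap.mkSpanSingleton'_apply_self _ _ _ _
  rw [← this]
  exact hg ⟨x, hx'⟩

/-- A separable normed space admits equivalent norms, arbitrarily close to the original one, for
which every point of a given sequence is, after normalization, strongly exposed in the unit
ball with a linear modulus. -/
theorem exists_seminorm_strongly_exposed (z : ℕ → Z) (hz : ∀ n, ‖z n‖ = 1) :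
    ∃ N : Seminorm ℝ Z, (∀ x, N x ≤ ‖x‖) ∧ ∀ μ : ℝ, 0 < μ → μ ≤ 1 → ∀ n,
      ∃ (h : Z →L[ℝ] ℝ) (R : ℝ), 0 < R ∧ (∀ x, |h x| ≤ ‖x‖ + μ * N x) ∧
        h (z n) = 1 + μ * N (z n) ∧
        ∀ x, ‖x‖ + μ * N x ≤ 1 → ‖x - (1 + μ * N (z n))⁻¹ • z n‖ ≤ R * (1 - h x) := by
  have hφ : ∀ n, ∃ φ : Z →L[ℝ] ℝ, ‖φ‖ = 1 ∧ φ (z n) = 1 := fun n => by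
    obtain ⟨φ, h1, h2⟩ := exists_dual_vector ℝ (z n) (by rw [hz]; exact one_ne_zero)
    exact ⟨φ, h1, by rw [h2, hz]; rfl⟩
  choose φ hφn hφz using hφ
  -- `L n` is the projection along `z n`, so `q n` measures the deviation from the line through `z
  -- n`.
  let L : ℕ → Z →L[ℝ] Z := fun n => ContinuousLinearMap.id ℝ Z - (φ n).smulRight (z n)
  let q : ℕ → Seminorm ℝ Z := fun n => (normSeminorm ℝ Z).comp (L n : Z →ₗ[ℝ] Z)
  have hqv : ∀ n x, q n x = ‖x - φ n x • z n‖ := fun n x => rfl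
  have hq : ∀ n x, q n x ≤ 2 * ‖x‖ := by
    intro n x
    rw [hqv]
    have : ‖φ n x • z n‖ ≤ ‖x‖ := by
      rw [norm_smul, hz, mul_one]
      simpa [hφn] using (φ n).le_opNorm x
    linarith [norm_sub_le x (φ n x • z n)]
  obtain ⟨N, hN, hsplit⟩ := exists_seminorm_split q hq
  refine ⟨N, hN, fun μ hμ hμ1 n => ?_⟩
  obtain ⟨c, hc, p, hp⟩ := hsplit n
  have hp0 : ∀ x, 0 ≤ p x := fun x => apply_nonneg p x
  have hq0 : ∀ x, 0 ≤ q n x := fun x => apply_nonneg (q n) x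
  have hpN : ∀ x, p x ≤ N x := fun x => by
    rw [hp]; linarith [mul_nonneg hc.le (hq0 x)]
  -- `P` is the new norm without its `q n` term. They agree at `z n`, so a support functional of `P`
  -- there is one of the new norm, with μ·c·`q n` to spare elsewhere.
  let P : Seminorm ℝ Z := normSeminorm ℝ Z + (NNReal.mk μ hμ.le) • p
  have hPv : ∀ x, P x = ‖x‖ + μ * p x := fun x => rfl
  have hPc : Continuous P := by
    refine Seminorm.continuous_of_le (q := (2 : NNReal) • normSeminorm ℝ Z)
      (continuous_norm.const_smul _) fun x => ?_
    change ‖x‖ + μ * p x ≤ 2 * ‖x‖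
    nlinarith [hpN x, hN x, hp0 x]
  obtain ⟨h, hhz, hh⟩ := exists_dual_le_seminorm hPc (x := z n)
    (norm_ne_zero_iff.1 (by rw [hz]; exact one_ne_zero))
  have hqz : q n (z n) = 0 := by rw [hqv, hφz]; simp
  have hpz : p (z n) = N (z n) := by rw [hp, hqz]; ring
  set ρ : ℝ := 1 + μ * N (z n) with hρ
  have hρ1 : 1 ≤ ρ := by
    have : 0 ≤ N (z n) := apply_nonneg N _
    rw [hρ]; nlinarith
  have hhz' : h (z n) = ρ := by rw [hhz, hPv, hz, hpz]
  have hhx : ∀ x, |h x| + μ * (c * q n x) ≤ ‖x‖ + μ * N x := fun x => by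
    have := hh x
    rw [hPv] at this
    rw [hp]; linarith
  have hh2 : ∀ x, |h x| ≤ 2 * ‖x‖ := fun x => (hh x).trans (by
    rw [hPv]; nlinarith [hpN x, hN x, hp0 x])
  refine ⟨h, 3 / (μ * c) + 1, by positivity, fun x => ?_, hhz', fun x hx => ?_⟩
  · have := hhx x
    have : 0 ≤ μ * (c * q n x) := mul_nonneg hμ.le (mul_nonneg hc.le (hq0 x))
    linarith [hhx x]
  have hx1 := hhx x
  have hq1 : q n x ≤ (1 - h x) / (μ * c) := by
    rw [le_div_iff₀ (by positivity)]
    linarith [le_abs_self (h x)]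
  have h1x : 0 ≤ 1 - h x := by
    have : 0 ≤ μ * (c * q n x) := mul_nonneg hμ.le (mul_nonneg hc.le (hq0 x))
    linarith [le_abs_self (h x)]
  -- The `q n` term controls the deviation from the line; the position along it is read off from
  -- `h`, since h(z n) = ρ.
  have hφx : |φ n x - ρ⁻¹| ≤ (1 - h x) + 2 * q n x := by
    have e1 : h (x - φ n x • z n) = h x - φ n x * ρ := by
      rw [map_sub, map_smul, hhz', smul_eq_mul]
    have e2 := hh2 (x - φ n x • z n)
    rw [e1, ← hqv] at e2
    have e3 : φ n x - ρ⁻¹ = (φ n x * ρ - 1) / ρ := by field_simp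
    rw [e3, abs_div, abs_of_pos (by linarith : 0 < ρ)]
    refine (div_le_self (abs_nonneg _) hρ1).trans ?_
    rw [abs_le] at e2 ⊢
    constructor <;> linarith
  have e4 : x - ρ⁻¹ • z n = (x - φ n x • z n) + (φ n x - ρ⁻¹) • z n := by
    rw [sub_smul]; abel
  calc ‖x - ρ⁻¹ • z n‖ ≤ q n x + |φ n x - ρ⁻¹| := by
        rw [e4, hqv]
        refine (norm_add_le _ _).trans (add_le_add le_rfl ?_)
        rw [norm_smul, hz, mul_one, Real.norm_eq_abs]
    _ ≤ 3 * ((1 - h x) / (μ * c)) + (1 - h x) := by linarith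
    _ = _ := by ring

end Normed

/-! ### Strongly exposed generators give SCD sets. -/

section Normed

variable {W : Type*} [NormedAddCommGroup W] [NormedSpace ℝ W]

/-- A bounded set generated by countably many points, each strongly exposed with a linear
modulus, is slicely countably determined. -/
theorem isSCD_of_strongly_exposed {C : Set W} (hC : Bornology.IsBounded C) {ι : Type*}
    [Countable ι] [Nonempty ι] (u : ι → W) (f : ι → W →L[ℝ] ℝ) (κ : ι → ℝ) (hκ : ∀ i, 0 < κ i)
    (hf : ∀ i, f i ≠ 0) (hu : ∀ i, u i ∈ C)
    (hexp : ∀ i, ∀ c ∈ C, f i c + κ i * ‖c - u i‖ ≤ f i (u i))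
    (hgen : C ⊆ closure (convexHull ℝ (Set.range u))) : IsSCD C := by
  have hsup : ∀ i, sSup (f i '' C) = f i (u i) := fun i =>
    IsGreatest.csSup_eq ⟨Set.mem_image_of_mem _ (hu i), by
      rintro _ ⟨c, hc, rfl⟩
      have := hexp i c hc
      have : 0 ≤ κ i * ‖c - u i‖ := mul_nonneg (hκ i).le (norm_nonneg _)
      linarith⟩
  have hmem : ∀ i (n : ℕ), u i ∈ sliceSet C (f i) (1 / ((n : ℝ) + 1)) := fun i n =>
    ⟨hu i, by rw [hsup]; linarith [Nat.one_div_pos_of_nat (α := ℝ) (n := n)]⟩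
  obtain ⟨e, he⟩ := exists_surjective_nat (ι × ℕ)
  refine ⟨hC, fun m => sliceSet C (f (e m).1) (1 / (((e m).2 : ℝ) + 1)), fun m =>
    ⟨⟨_, hmem _ _⟩, _, hf _, _, Nat.one_div_pos_of_nat, rfl⟩,
    fun m => ⟨⟨_, hmem _ _⟩, fun c hc => hc.1⟩, fun B hB => ?_⟩
  refine hgen.trans (closure_minimal (convexHull_min ?_ (convex_convexHull ℝ B).closure)
    isClosed_closure)
  rintro _ ⟨i, rfl⟩
  refine closure_mono (subset_convexHull ℝ B) (Metric.mem_closure_iff.2 fun δ hδ => ?_)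
  -- A point b of the slice of width 1/(n+1) at `u i` satisfies κ‖b - u i‖ < 1/(n+1), so `B`
  -- accumulates at, or contains, every `u i`.
  obtain ⟨n, hn⟩ := exists_nat_one_div_lt (mul_pos (hκ i) hδ)
  obtain ⟨m, hm⟩ := he (i, n)
  obtain ⟨b, hbB, hb⟩ := hB m
  simp only [hm] at hb
  refine ⟨b, hbB, ?_⟩
  have h1 := hexp i b hb.1
  have h2 := hb.2
  rw [hsup] at h2
  rw [dist_comm, dist_eq_norm]
  exact lt_of_mul_lt_mul_left (by linarith) (hκ i).le

end Normed

/-! ### Bodies in Z × ℝ attached to a curve. -/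

section Product

variable {Z : Type*} [NormedAddCommGroup Z] [NormedSpace ℝ Z]

/-- Numerical data of a strictly convex polygonal curve with vertices `(α k, β k)` converging
to `(1, 1)`, exposed by `(a k, t k)` with gap `γ k`, and perturbation parameters `μ k`. -/
structure CurveData (α β a t γ μ : ℕ → ℝ) : Prop where
  α_pos : ∀ k, 0 < α k
  α_le : ∀ k, α k ≤ 3 / 2
  β_pos : ∀ k, 0 < β k
  β_le : ∀ k, β k ≤ 3 / 2
  α_tendsto : Filter.Tendsto α Filter.atTop (nhds 1)
  β_tendsto : Filter.Tendsto β Filter.atTop (nhds 1)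
  a_pos : ∀ k, 0 < a k
  t_pos : ∀ k, 0 < t k
  γ_pos : ∀ k, 0 < γ k
  μ_pos : ∀ k, 0 < μ k
  μ_le : ∀ k, μ k ≤ 1
  μ_tendsto : Filter.Tendsto μ Filter.atTop (nhds 0)
  μ_gap : ∀ k, 3 * (μ k * a k) ≤ γ k
  gap : ∀ k j, j ≠ k → a k * α j + t k * β j + γ k ≤ a k * α k + t k * β k

/-- The vertices of the level `k = i.1` of the body attached to the data of `CurveData`. -/
noncomputable def vertex (N : Seminorm ℝ Z) (z : ℕ → Z) (α β μ : ℕ → ℝ)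
    (i : ℕ × ℕ × ℤˣ × ℤˣ) : Z × ℝ :=
  ((((i.2.2.1 : ℤ) : ℝ) * α i.1) • (1 + μ i.1 * N (z i.2.1))⁻¹ • z i.2.1,
    ((i.2.2.2 : ℤ) : ℝ) * β i.1)

theorem units_sq (ε : ℤˣ) : ((ε : ℤ) : ℝ) * ((ε : ℤ) : ℝ) = 1 := by
  rcases Int.units_eq_one_or ε with rfl | rfl <;> norm_num

theorem abs_units (ε : ℤˣ) : |((ε : ℤ) : ℝ)| = 1 := by
  rcases Int.units_eq_one_or ε with rfl | rfl <;> norm_num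

theorem one_le_renorm (N : Seminorm ℝ Z) {μ : ℝ} (hμ : 0 < μ) (x : Z) : 1 ≤ 1 + μ * N x := by
  have : 0 ≤ N x := apply_nonneg N x
  nlinarith

theorem norm_inv_smul_le (N : Seminorm ℝ Z) {μ : ℝ} (hμ : 0 < μ) {x : Z} (hx : ‖x‖ = 1) :
    ‖(1 + μ * N x)⁻¹ • x‖ ≤ 1 := by
  have h1 := one_le_renorm N hμ x
  rw [norm_smul, hx, mul_one, norm_inv, Real.norm_of_nonneg (by linarith)]
  exact inv_le_one_of_one_le₀ h1

theorem renorm_inv_smul (N : Seminorm ℝ Z) {μ : ℝ} (hμ : 0 < μ) {x : Z} (hx : ‖x‖ = 1) :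
    ‖(1 + μ * N x)⁻¹ • x‖ + μ * N ((1 + μ * N x)⁻¹ • x) = 1 := by
  have h1 := one_le_renorm N hμ x
  rw [map_smul_eq_mul, norm_smul, hx, norm_inv, Real.norm_of_nonneg (by linarith)]
  field_simp

theorem clm_prod_apply (f : Z × ℝ →L[ℝ] ℝ) (x : Z) (s : ℝ) :
    f (x, s) = f.comp (ContinuousLinearMap.inl ℝ Z ℝ) x + s * f (0, 1) := by
  have : (x, s) = (x, (0 : ℝ)) + s • ((0 : Z), (1 : ℝ)) := by simp
  rw [this, map_add, map_smul, smul_eq_mul]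
  rfl

section Vertex

variable {N : Seminorm ℝ Z} {z : ℕ → Z} {α β a t γ μ : ℕ → ℝ}

theorem norm_vertex_le (hd : CurveData α β a t γ μ) (hz : ∀ n, ‖z n‖ = 1)
    (i : ℕ × ℕ × ℤˣ × ℤˣ) : ‖vertex N z α β μ i‖ ≤ 3 / 2 := by
  have h1 := norm_inv_smul_le N (hd.μ_pos i.1) (hz i.2.1)
  rw [vertex, Prod.norm_def]
  refine max_le ?_ ?_
  · rw [norm_smul, norm_mul, Real.norm_eq_abs, abs_units, one_mul,
      Real.norm_of_nonneg (hd.α_pos _).le]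
    nlinarith [hd.α_pos i.1, hd.α_le i.1]
  · rw [norm_mul, Real.norm_eq_abs, abs_units, one_mul, Real.norm_of_nonneg (hd.β_pos _).le]
    exact hd.β_le _

theorem apply_vertex_le (hd : CurveData α β a t γ μ) (hz : ∀ n, ‖z n‖ = 1)
    (f : Z × ℝ →L[ℝ] ℝ) (i : ℕ × ℕ × ℤˣ × ℤˣ) :
    f (vertex N z α β μ i) ≤
      α i.1 * ‖f.comp (ContinuousLinearMap.inl ℝ Z ℝ)‖ + β i.1 * |f (0, 1)| := by
  have h1 := norm_inv_smul_le N (hd.μ_pos i.1) (hz i.2.1)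
  rw [vertex, clm_prod_apply]
  set g := f.comp (ContinuousLinearMap.inl ℝ Z ℝ)
  refine add_le_add ?_ ?_
  · refine (le_abs_self _).trans ?_
    rw [map_smul, smul_eq_mul, abs_mul, abs_mul, abs_units, one_mul, abs_of_pos (hd.α_pos _)]
    refine mul_le_mul_of_nonneg_left ?_ (hd.α_pos _).le
    exact (g.le_opNorm _).trans (mul_le_of_le_one_right (norm_nonneg _) h1)
  · refine (le_abs_self _).trans ?_
    rw [abs_mul, abs_mul, abs_units, one_mul, abs_of_pos (hd.β_pos _)]

theorem neg_vertex (i : ℕ × ℕ × ℤˣ × ℤˣ) :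
    -vertex N z α β μ i = vertex N z α β μ (i.1, i.2.1, -i.2.2.1, -i.2.2.2) := by
  simp [vertex, neg_smul]

/-- The exposing functional combines `h`, which exposes the direction within level k, with the
weights (a k, t k), which expose (α k, β k) among the other levels. -/
theorem vertex_exposed (hd : CurveData α β a t γ μ) (hz : ∀ n, ‖z n‖ = 1)
    (hN : ∀ x, N x ≤ ‖x‖) (i : ℕ × ℕ × ℤˣ × ℤˣ) (h : Z →L[ℝ] ℝ) (R : ℝ) (hR : 0 < R)
    (hh : ∀ x, |h x| ≤ ‖x‖ + μ i.1 * N x)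
    (hhz : h (z i.2.1) = 1 + μ i.1 * N (z i.2.1))
    (hexp : ∀ x, ‖x‖ + μ i.1 * N x ≤ 1 →
      ‖x - (1 + μ i.1 * N (z i.2.1))⁻¹ • z i.2.1‖ ≤ R * (1 - h x)) :
    ∃ (f : Z × ℝ →L[ℝ] ℝ) (κ : ℝ), 0 < κ ∧ f ≠ 0 ∧ ∀ j,
      f (vertex N z α β μ j) + κ * ‖vertex N z α β μ j - vertex N z α β μ i‖ ≤
        f (vertex N z α β μ i) := by
  obtain ⟨k, n, ε, σ⟩ := i
  simp only at hh hhz hexp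
  have hα := hd.α_pos k
  have hβ := hd.β_pos k
  have ha := hd.a_pos k
  have ht := hd.t_pos k
  have hγ := hd.γ_pos k
  have hμ := hd.μ_pos k
  set v : Z := (1 + μ k * N (z n))⁻¹ • z n with hv
  have hρ := one_le_renorm N hμ (z n)
  have hhv : h v = 1 := by
    rw [hv, map_smul, hhz, smul_eq_mul, inv_mul_cancel₀ (by linarith)]
  let f : Z × ℝ →L[ℝ] ℝ := (((ε : ℤ) : ℝ) * a k) • h.comp (ContinuousLinearMap.fst ℝ Z ℝ) +
    (((σ : ℤ) : ℝ) * t k) • ContinuousLinearMap.snd ℝ Z ℝ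
  have hf : ∀ x s, f (x, s) = ((ε : ℤ) : ℝ) * a k * h x + ((σ : ℤ) : ℝ) * t k * s :=
    fun x s => rfl
  have hfi : f (vertex N z α β μ (k, n, ε, σ)) = a k * α k + t k * β k := by
    rw [vertex, hf]
    simp only [← hv, map_smul, smul_eq_mul, hhv]
    linear_combination (a k * α k) * units_sq ε + (t k * β k) * units_sq σ
  -- The three bounds serve, in order, other levels, the Z-component within level k, and the sign of
  -- the last coordinate there.
  refine ⟨f, min (γ k / 6) (min (a k / R) (t k)), by positivity, fun h0 => ?_, ?_⟩
  · have : f (vertex N z α β μ (k, n, ε, σ)) = 0 := by rw [h0]; rfl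
    have : 0 < a k * α k + t k * β k := by positivity
    linarith
  rintro ⟨j, m, ε', σ'⟩
  rw [hfi]
  have hκ1 := min_le_left (γ k / 6) (min (a k / R) (t k))
  have hκ2 := (min_le_right (γ k / 6) (min (a k / R) (t k))).trans (min_le_left _ _)
  have hκ3 := (min_le_right (γ k / 6) (min (a k / R) (t k))).trans (min_le_right _ _)
  have hκ0 : 0 < min (γ k / 6) (min (a k / R) (t k)) := by positivity
  set κ := min (γ k / 6) (min (a k / R) (t k))
  set w : Z := (1 + μ j * N (z m))⁻¹ • z m with hw
  have hσσ : ((σ : ℤ) : ℝ) * ((σ' : ℤ) : ℝ) ≤ 1 := by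
    have : |((σ : ℤ) : ℝ) * ((σ' : ℤ) : ℝ)| = 1 := by rw [abs_mul, abs_units, abs_units, one_mul]
    exact (le_abs_self _).trans this.le
  have hw1 : ‖w‖ ≤ 1 := norm_inv_smul_le N (hd.μ_pos j) (hz m)
  have hfj : f (vertex N z α β μ (j, m, ε', σ')) =
      a k * α j * h ((((ε : ℤ) : ℝ) * ((ε' : ℤ) : ℝ)) • w) +
        t k * β j * (((σ : ℤ) : ℝ) * ((σ' : ℤ) : ℝ)) := by
    rw [vertex, hf]
    simp only [← hw, map_smul, smul_eq_mul]
    ring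
  have hee : |((ε : ℤ) : ℝ) * ((ε' : ℤ) : ℝ)| = 1 := by
    rw [abs_mul, abs_units, abs_units, one_mul]
  rw [hfj]
  by_cases hjk : j = k
  · subst hjk
    set w' : Z := (((ε : ℤ) : ℝ) * ((ε' : ℤ) : ℝ)) • w with hw'
    have hw'1 : ‖w'‖ + μ j * N w' ≤ 1 := by
      rw [hw', map_smul_eq_mul, norm_smul, Real.norm_eq_abs, hee, one_mul, one_mul]
      exact (renorm_inv_smul N (hd.μ_pos j) (hz m)).le
    have h2 := hexp w' hw'1
    have hdist : ‖vertex N z α β μ (j, m, ε', σ') - vertex N z α β μ (j, n, ε, σ)‖ ≤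
        α j * ‖w' - v‖ + β j * (1 - ((σ : ℤ) : ℝ) * ((σ' : ℤ) : ℝ)) := by
      have hx : (((ε' : ℤ) : ℝ) * α j) • w - (((ε : ℤ) : ℝ) * α j) • v =
          (((ε : ℤ) : ℝ) * α j) • (w' - v) := by
        rw [hw', smul_sub, smul_smul (((ε : ℤ) : ℝ) * α j) (((ε : ℤ) : ℝ) * ((ε' : ℤ) : ℝ)) w]
        congr 2
        linear_combination -(((ε' : ℤ) : ℝ) * α j) * units_sq ε
      have hs : ((σ' : ℤ) : ℝ) * β j - ((σ : ℤ) : ℝ) * β j =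
          -((σ : ℤ) : ℝ) * (β j * (1 - ((σ : ℤ) : ℝ) * ((σ' : ℤ) : ℝ))) := by
        linear_combination -(((σ' : ℤ) : ℝ) * β j) * units_sq σ
      rw [vertex, vertex, Prod.mk_sub_mk, Prod.norm_def]
      simp only [← hw, ← hv]
      rw [hx, hs, norm_smul, norm_mul, norm_mul, norm_neg, Real.norm_eq_abs, Real.norm_eq_abs,
        Real.norm_eq_abs, Real.norm_eq_abs, abs_units, abs_units, one_mul, one_mul,
        abs_of_pos hα, abs_of_nonneg (mul_nonneg hβ.le (by linarith))]
      exact max_le_add_of_nonneg (by positivity) (mul_nonneg hβ.le (by linarith))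
    have h3 : κ * ‖w' - v‖ ≤ a j * (1 - h w') := by
      calc κ * ‖w' - v‖ ≤ a j / R * (R * (1 - h w')) := by gcongr
        _ = _ := by field_simp
    have h4 : κ * (1 - ((σ : ℤ) : ℝ) * ((σ' : ℤ) : ℝ)) ≤
        t j * (1 - ((σ : ℤ) : ℝ) * ((σ' : ℤ) : ℝ)) :=
      mul_le_mul_of_nonneg_right hκ3 (by linarith)
    have h5 := mul_le_mul_of_nonneg_left hdist hκ0.le
    have h6 := mul_le_mul_of_nonneg_left h3 hα.le
    have h7 := mul_le_mul_of_nonneg_left h4 hβ.le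
    linarith
  · have hgap := hd.gap k j hjk
    have hdist : ‖vertex N z α β μ (j, m, ε', σ') - vertex N z α β μ (k, n, ε, σ)‖ ≤ 3 := by
      refine (norm_sub_le _ _).trans ?_
      linarith [norm_vertex_le (N := N) hd hz (j, m, ε', σ'),
        norm_vertex_le (N := N) hd hz (k, n, ε, σ)]
    -- At other levels `h` may exceed 1 by up to μ k. By `μ_gap` and α ≤ 3/2 this costs at most half
    -- the gap; the other half pays for κ times the distance, which is at most 3.
    have hhw : h ((((ε : ℤ) : ℝ) * ((ε' : ℤ) : ℝ)) • w) ≤ 1 + μ k := by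
      refine (le_abs_self _).trans ?_
      rw [map_smul, smul_eq_mul, abs_mul, hee, one_mul]
      refine (hh w).trans ?_
      nlinarith [hN w]
    have h1 : a k * α j * h ((((ε : ℤ) : ℝ) * ((ε' : ℤ) : ℝ)) • w) ≤
        a k * α j + γ k / 2 := by
      have e1 : 0 < a k * α j := mul_pos ha (hd.α_pos j)
      have e2 := mul_le_mul_of_nonneg_left hhw e1.le
      have e3 : a k * μ k * α j ≤ a k * μ k * (3 / 2) :=
        mul_le_mul_of_nonneg_left (hd.α_le j) (by positivity)
      linarith [hd.μ_gap k]
    have h2 : t k * β j * (((σ : ℤ) : ℝ) * ((σ' : ℤ) : ℝ)) ≤ t k * β j :=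
      mul_le_of_le_one_right (mul_pos ht (hd.β_pos j)).le hσσ
    have h3 : κ * ‖vertex N z α β μ (j, m, ε', σ') - vertex N z α β μ (k, n, ε, σ)‖ ≤
        γ k / 6 * 3 := by gcongr
    linarith

/-- Since (α k, β k) → (1, 1) and μ k → 0, the vertices accumulate at every point of the unit sphere
of Z times {±1}, whose convex hull is the ball. -/
theorem ball_subset_closure_convexHull_vertex [Nontrivial Z] (hd : CurveData α β a t γ μ)
    (hz : ∀ n, ‖z n‖ = 1) (hN : ∀ x, N x ≤ ‖x‖)
    (hdense : ∀ y : Z, ‖y‖ = 1 → ∀ δ : ℝ, 0 < δ → ∃ n, ‖z n - y‖ < δ) :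
    Metric.closedBall (0 : Z × ℝ) 1 ⊆
      closure (convexHull ℝ (Set.range (vertex N z α β μ))) := by
  set A := closure (convexHull ℝ (Set.range (vertex N z α β μ))) with hA
  have hAc : Convex ℝ A := (convex_convexHull ℝ _).closure
  have hsphere : ∀ y : Z, ‖y‖ = 1 → ∀ σ : ℤˣ, (y, ((σ : ℤ) : ℝ)) ∈ A := by
    intro y hy σ
    choose n hn using fun k : ℕ => hdense y hy (1 / ((k : ℝ) + 1)) Nat.one_div_pos_of_nat
    have hzn : Filter.Tendsto (fun k => z (n k)) Filter.atTop (nhds y) := by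
      rw [tendsto_iff_norm_sub_tendsto_zero]
      exact squeeze_zero (fun _ => norm_nonneg _) (fun k => (hn k).le)
        tendsto_one_div_add_atTop_nhds_zero_nat
    have hμN : Filter.Tendsto (fun k => μ k * N (z (n k))) Filter.atTop (nhds 0) :=
      squeeze_zero (fun k => mul_nonneg (hd.μ_pos k).le (apply_nonneg N _))
        (fun k => mul_le_of_le_one_right (hd.μ_pos k).le ((hN _).trans (hz _).le)) hd.μ_tendsto
    have hρ : Filter.Tendsto (fun k => (1 + μ k * N (z (n k)))⁻¹) Filter.atTop (nhds 1) := by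
      simpa using (hμN.const_add 1).inv₀ (by norm_num)
    have hlim : Filter.Tendsto (fun k => vertex N z α β μ (k, n k, 1, σ)) Filter.atTop
        (nhds (y, ((σ : ℤ) : ℝ))) := by
      refine Filter.Tendsto.prodMk_nhds ?_ ?_
      · simpa using hd.α_tendsto.smul (hρ.smul hzn)
      · simpa using hd.β_tendsto.const_mul ((σ : ℤ) : ℝ)
    exact mem_closure_of_tendsto hlim
      (Filter.Eventually.of_forall fun k => subset_convexHull ℝ _ (Set.mem_range_self _))
  have hcyl : ∀ y : Z, ‖y‖ = 1 → ∀ s : ℝ, |s| ≤ 1 → (y, s) ∈ A := by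
    intro y hy s hs
    rw [abs_le] at hs
    have := hAc (hsphere y hy 1) (hsphere y hy (-1)) (a := (1 + s) / 2) (b := (1 - s) / 2)
      (by linarith) (by linarith) (by ring)
    convert this using 1
    ext1
    · simp only [Prod.smul_mk, Prod.mk_add_mk, ← add_smul]
      rw [show (1 + s) / 2 + (1 - s) / 2 = 1 by ring, one_smul]
    · simp only [Prod.smul_mk, Prod.mk_add_mk, smul_eq_mul, Units.val_one, Int.cast_one,
        Units.val_neg, Int.cast_neg]
      ring
  rintro ⟨y, s⟩ hys
  rw [mem_closedBall_zero_iff, Prod.norm_def, max_le_iff] at hys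
  obtain ⟨hy, hs⟩ := hys
  obtain ⟨e, he, hye⟩ : ∃ e : Z, ‖e‖ = 1 ∧ y = ‖y‖ • e := by
    rcases eq_or_ne y 0 with rfl | h0
    · obtain ⟨e, he⟩ := exists_norm_eq Z zero_le_one
      exact ⟨e, he, by simp⟩
    · have h1 : ‖y‖ ≠ 0 := norm_ne_zero_iff.2 h0
      exact ⟨‖y‖⁻¹ • y, by rw [norm_smul, norm_inv, norm_norm, inv_mul_cancel₀ h1],
        by rw [smul_smul, mul_inv_cancel₀ h1, one_smul]⟩
  have := hAc (hcyl e he s hs) (hcyl (-e) (by rwa [norm_neg]) s hs) (a := (1 + ‖y‖) / 2)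
    (b := (1 - ‖y‖) / 2) (by positivity) (by simp only at hy; linarith) (by ring)
  convert this using 1
  ext1
  · simp only [Prod.smul_mk, Prod.mk_add_mk, smul_neg, ← sub_eq_add_neg, ← sub_smul]
    rw [show (1 + ‖y‖) / 2 - (1 - ‖y‖) / 2 = ‖y‖ by ring]
    exact hye
  · simp only [Prod.smul_mk, Prod.mk_add_mk, smul_eq_mul]
    ring

end Vertex

theorem exists_dense_seq_sphere [Nontrivial Z] [TopologicalSpace.SeparableSpace Z] :
    ∃ z : ℕ → Z, (∀ n, ‖z n‖ = 1) ∧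
      ∀ y : Z, ‖y‖ = 1 → ∀ δ : ℝ, 0 < δ → ∃ n, ‖z n - y‖ < δ := by
  obtain ⟨e, he⟩ := exists_norm_eq Z zero_le_one
  have : Nonempty (Metric.sphere (0 : Z) 1) := ⟨⟨e, by simpa using he⟩⟩
  have : SecondCountableTopology Z := UniformSpace.secondCountable_of_separable Z
  refine ⟨fun n => (TopologicalSpace.denseSeq (Metric.sphere (0 : Z) 1) n : Z), fun n => ?_,
    fun y hy δ hδ => ?_⟩
  · simp
  · obtain ⟨n, hn⟩ := (TopologicalSpace.denseRange_denseSeq (Metric.sphere (0 : Z) 1)).exists_dist_lt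
      ⟨y, by simpa using hy⟩ hδ
    rw [dist_comm, Subtype.dist_eq, dist_eq_norm] at hn
    exact ⟨n, hn⟩

theorem CurveData.exists_isSCD [Nontrivial Z] [TopologicalSpace.SeparableSpace Z]
    {α β a t γ μ : ℕ → ℝ} (hd : CurveData α β a t γ μ) :
    ∃ C : Set (Z × ℝ), Convex ℝ C ∧ IsClosed C ∧ -C = C ∧ IsSCD C ∧
      Metric.closedBall 0 1 ⊆ C ∧ (∀ c ∈ C, ‖c‖ ≤ 3 / 2) ∧
      ∀ (f : Z × ℝ →L[ℝ] ℝ) (r : ℝ),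
        (∀ j, α j * ‖f.comp (ContinuousLinearMap.inl ℝ Z ℝ)‖ + β j * |f (0, 1)| ≤ r) →
        ∀ c ∈ C, f c ≤ r := by
  obtain ⟨z, hz, hdense⟩ := exists_dense_seq_sphere (Z := Z)
  obtain ⟨N, hN, hexp⟩ := exists_seminorm_strongly_exposed z hz
  have hv := fun i : ℕ × ℕ × ℤˣ × ℤˣ => hexp (μ i.1) (hd.μ_pos _) (hd.μ_le _) i.2.1
  choose h R hR hh hhz hhexp using hv
  choose f κ hκ hf hfκ using fun i => vertex_exposed hd hz hN i (h i) (R i) (hR i) (hh i) (hhz i)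
    (hhexp i)
  have hconv := (convex_convexHull ℝ (Set.range (vertex N z α β μ))).closure
  have hsub : Set.range (vertex N z α β μ) ⊆
      closure (convexHull ℝ (Set.range (vertex N z α β μ))) :=
    (subset_convexHull ℝ _).trans subset_closure
  have hball : closure (convexHull ℝ (Set.range (vertex N z α β μ))) ⊆
      Metric.closedBall 0 (3 / 2) := by
    refine closure_minimal (convexHull_min ?_ (convex_closedBall _ _)) Metric.isClosed_closedBall
    rintro _ ⟨i, rfl⟩
    rw [mem_closedBall_zero_iff]
    exact norm_vertex_le hd hz i
  have hle : ∀ φ : Z × ℝ → ℝ, ConvexOn ℝ Set.univ φ → Continuous φ → ∀ r : ℝ,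
      (∀ i, φ (vertex N z α β μ i) ≤ r) →
      ∀ c ∈ closure (convexHull ℝ (Set.range (vertex N z α β μ))), φ c ≤ r := by
    intro φ hφ hφc r hr
    have hcv : Convex ℝ {c | φ c ≤ r} := by simpa using hφ.convex_le r
    refine closure_minimal (t := {c | φ c ≤ r}) (convexHull_min ?_ hcv)
      (isClosed_le hφc continuous_const)
    rintro _ ⟨i, rfl⟩
    exact hr i
  refine ⟨closure (convexHull ℝ (Set.range (vertex N z α β μ))), hconv, isClosed_closure, ?_, ?_,
    ball_subset_closure_convexHull_vertex hd hz hN hdense, fun c hc => by simpa using hball hc, ?_⟩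
  · have hr : -Set.range (vertex N z α β μ) = Set.range (vertex N z α β μ) := by
      rw [← Set.image_neg_eq_neg]
      refine Set.Subset.antisymm ?_ ?_
      · rintro _ ⟨_, ⟨i, rfl⟩, rfl⟩
        exact ⟨_, (neg_vertex i).symm⟩
      · rintro _ ⟨i, rfl⟩
        exact ⟨-vertex N z α β μ i, ⟨_, (neg_vertex i).symm⟩, neg_neg _⟩
    rw [neg_closure, ← convexHull_neg, hr]
  · refine isSCD_of_strongly_exposed (Metric.isBounded_closedBall.subset hball)
      (vertex N z α β μ) f κ hκ hf (fun i => hsub (Set.mem_range_self i)) (fun i => ?_) le_rfl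
    -- The exposing inequality bounds a continuous convex function, so it passes from the vertices
    -- to their closed convex hull.
    refine hle (fun c => f i c + κ i * ‖c - vertex N z α β μ i‖) ?_ (by fun_prop) _ (hfκ i)
    refine ((f i).toLinearMap.convexOn convex_univ).add ?_
    have := (convexOn_univ_norm (E := Z × ℝ)).translate_left (c := -vertex N z α β μ i)
    refine ConvexOn.smul (hκ i).le ?_
    simpa [Function.comp_def, sub_eq_add_neg] using this
  · intro g r hr
    exact hle g (g.toLinearMap.convexOn convex_univ) g.continuous r fun i =>
      (apply_vertex_le hd hz g i).trans (hr i.1)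

end Product

/-! ### The two explicit curves. -/

section Curve

theorem quarter_pow_gap {j k : ℕ} (hjk : j ≠ k) :
    ((1 / 4 : ℝ) ^ (k + 1)) ^ 2 / 4 ≤ ((1 / 4 : ℝ) ^ (j + 1) - (1 / 4) ^ (k + 1)) ^ 2 := by
  have hp : ∀ {m n : ℕ}, m < n → (1 / 4 : ℝ) ^ (n + 1) ≤ 1 / 4 * (1 / 4) ^ (m + 1) := by
    intro m n hmn
    rw [← pow_succ']
    exact pow_le_pow_of_le_one (by norm_num) (by norm_num) (by omega)
  have hj : (0 : ℝ) < (1 / 4) ^ (j + 1) := by positivity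
  have hk : (0 : ℝ) < (1 / 4) ^ (k + 1) := by positivity
  rcases lt_or_gt_of_ne hjk with h | h
  · have := hp h
    nlinarith
  · have := hp h
    nlinarith

theorem quarter_pow_le (k : ℕ) : (1 / 4 : ℝ) ^ (k + 1) ≤ 1 / 4 := by
  rw [pow_succ']
  exact mul_le_of_le_one_right (by norm_num) (pow_le_one₀ (by norm_num) (by norm_num))

theorem tendsto_quarter_pow :
    Filter.Tendsto (fun k : ℕ => (1 / 4 : ℝ) ^ (k + 1)) Filter.atTop (nhds 0) :=
  (Filter.tendsto_add_atTop_iff_nat 1).2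
    (tendsto_pow_atTop_nhds_zero_of_lt_one (by norm_num) (by norm_num))

/-- The vertices are (1 - x - x², 1 + x) with x = 4^{-(k+1)}. Along this curve the weights (1, 1 +
2x_k) give a constant minus (x - x_k)², so x_k is the strict maximum. The factor 24 also leaves room
for `μ_gap` after exchanging the coordinates. -/
theorem curveData_steep : CurveData (fun k => 1 - (1 / 4) ^ (k + 1) - ((1 / 4) ^ (k + 1)) ^ 2)
    (fun k => 1 + (1 / 4) ^ (k + 1)) (fun _ => 1) (fun k => 1 + 2 * (1 / 4) ^ (k + 1))
    (fun k => ((1 / 4) ^ (k + 1)) ^ 2 / 4) (fun k => ((1 / 4) ^ (k + 1)) ^ 2 / 24) where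
  α_pos k := by
    have h0 : (0 : ℝ) < (1 / 4) ^ (k + 1) := by positivity
    nlinarith [quarter_pow_le k]
  α_le k := by
    have h0 : (0 : ℝ) < (1 / 4) ^ (k + 1) := by positivity
    nlinarith [quarter_pow_le k]
  β_pos k := by positivity
  β_le k := by linarith [quarter_pow_le k]
  α_tendsto := by
    simpa using (tendsto_quarter_pow.const_sub 1).sub (tendsto_quarter_pow.pow 2)
  β_tendsto := by simpa using tendsto_quarter_pow.const_add 1
  a_pos k := one_pos
  t_pos k := by positivity
  γ_pos k := by positivity
  μ_pos k := by positivity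
  μ_le k := by
    have h0 : (0 : ℝ) < (1 / 4) ^ (k + 1) := by positivity
    nlinarith [quarter_pow_le k]
  μ_tendsto := by simpa using (tendsto_quarter_pow.pow 2).div_const 24
  μ_gap k := by
    have h0 : (0 : ℝ) < (1 / 4) ^ (k + 1) := by positivity
    nlinarith
  gap k j hjk := by
    have := quarter_pow_gap hjk
    nlinarith

theorem CurveData.swap {α β a t γ μ : ℕ → ℝ} (hd : CurveData α β a t γ μ)
    (hμ : ∀ k, 3 * (μ k * t k) ≤ γ k) : CurveData β α t a γ μ where
  α_pos := hd.β_pos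
  α_le := hd.β_le
  β_pos := hd.α_pos
  β_le := hd.α_le
  α_tendsto := hd.β_tendsto
  β_tendsto := hd.α_tendsto
  a_pos := hd.t_pos
  t_pos := hd.a_pos
  γ_pos := hd.γ_pos
  μ_pos := hd.μ_pos
  μ_le := hd.μ_le
  μ_tendsto := hd.μ_tendsto
  μ_gap := hμ
  gap k j hjk := by linarith [hd.gap k j hjk]

theorem curveData_flat : CurveData (fun k => 1 + (1 / 4) ^ (k + 1))
    (fun k => 1 - (1 / 4) ^ (k + 1) - ((1 / 4) ^ (k + 1)) ^ 2)
    (fun k => 1 + 2 * (1 / 4) ^ (k + 1)) (fun _ => 1)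
    (fun k => ((1 / 4) ^ (k + 1)) ^ 2 / 4) (fun k => ((1 / 4) ^ (k + 1)) ^ 2 / 24) :=
  curveData_steep.swap fun k => by
    have h0 : (0 : ℝ) < (1 / 4) ^ (k + 1) := by positivity
    nlinarith [quarter_pow_le k, sq_nonneg ((1 / 4 : ℝ) ^ (k + 1))]

end Curve

/-! ### Slices of the sum. -/

section Sum

variable {Z : Type*} [NormedAddCommGroup Z] [NormedSpace ℝ Z]

/-- In a space with the slice form of the Daugavet property, one can choose a point in each of
countably many slices of the ball so that finitely many of them are almost separated from a
given point by a functional of norm at most one. -/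
theorem DaugavetSlices.exists_seq (hZ : DaugavetSlices Z) (y : Z) (h : ℕ → Z →L[ℝ] ℝ)
    (ε : ℕ → ℝ) (hε : ∀ n, 0 < ε n) {η : ℝ} (hη : 0 < η) :
    ∃ b : ℕ → Z, (∀ n, ‖b n‖ ≤ 1) ∧ (∀ n, ‖h n‖ - ε n < h n (b n)) ∧
      ∀ M : ℕ, ∃ φ : Z →L[ℝ] ℝ, ‖φ‖ ≤ 1 ∧ ‖y‖ - η ≤ φ y ∧ ∀ i < M, φ (b i) ≤ -1 + η := by
  choose g hg1 hgh hgn using fun (x : Z) (n : ℕ) =>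
    hZ (-x) (h n) (min (ε n) (η / 2 * (1 / 2) ^ n)) (lt_min (hε n) (by positivity))
  -- `s n` is y minus the points chosen so far. Each new point raises the norm by almost 1, and the
  -- losses add up to at most η.
  let s : ℕ → Z := fun n => Nat.rec y (fun n x => x - g x n) n
  have hs : ∀ n, s (n + 1) = s n - g (s n) n := fun n => rfl
  have hnorm : ∀ n, ‖y‖ + n - η * (1 - (1 / 2) ^ n) ≤ ‖s n‖ := by
    intro n
    induction n with
    | zero => simp [s]
    | succ n ih =>
      have h1 := hgn (s n) n
      have h2 : ‖s (n + 1)‖ = ‖-s n + g (s n) n‖ := by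
        rw [hs, ← norm_neg]; congr 1; abel
      have h3 := min_le_right (ε n) (η / 2 * (1 / 2) ^ n)
      rw [norm_neg] at h1
      rw [h2, pow_succ]
      push_cast
      linarith
  have hsum : ∀ n, s n = y - ∑ i ∈ Finset.range n, g (s i) i := by
    intro n
    induction n with
    | zero => simp [s]
    | succ n ih => rw [hs, Finset.sum_range_succ, ← sub_sub, ← ih]
  refine ⟨fun n => g (s n) n, fun n => hg1 _ _, fun n => ?_, fun M => ?_⟩
  · linarith [hgh (s n) n, min_le_left (ε n) (η / 2 * (1 / 2) ^ n)]
  -- The numbers φ(y) and -φ(b i) are at most ‖y‖ and 1, and their sum is within η of ‖y‖ + M, so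
  -- each is within η of its bound.
  obtain ⟨φ, hφ, hφs⟩ := exists_dual_vector'' ℝ (s M)
  have hφs' : φ y + ∑ i ∈ Finset.range M, φ (-g (s i) i) = ‖s M‖ := by
    rw [← map_sum, ← map_add, Finset.sum_neg_distrib, ← sub_eq_add_neg, ← hsum]
    exact hφs
  have hM := hnorm M
  have hpow : 0 ≤ η * (1 / 2 : ℝ) ^ M := by positivity
  have hφb : ∀ i, φ (-g (s i) i) ≤ 1 := fun i =>
    (apply_le_norm_of_opNorm_le_one hφ _).trans (by rw [norm_neg]; exact hg1 _ _)
  have hφy := apply_le_norm_of_opNorm_le_one hφ y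
  refine ⟨φ, hφ, ?_, fun i hi => ?_⟩
  · have : ∑ i ∈ Finset.range M, φ (-g (s i) i) ≤ M := by
      simpa using Finset.sum_le_card_nsmul (Finset.range M) _ 1 fun i _ => hφb i
    linarith
  · have h1 : ∑ j ∈ (Finset.range M).erase i, φ (-g (s j) j) ≤ M - 1 := by
      have := Finset.sum_le_card_nsmul ((Finset.range M).erase i) _ 1 fun j _ => hφb j
      rw [Finset.card_erase_of_mem (Finset.mem_range.2 hi), Finset.card_range, nsmul_eq_mul,
        Nat.cast_sub (by omega)] at this
      simpa using this
    have h2 := Finset.add_sum_erase (Finset.range M) (fun j => φ (-g (s j) j))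
      (Finset.mem_range.2 hi)
    simp only [map_neg] at h1 h2 hφs'
    linarith

/-- Needed because the functional in `DaugavetSlices.exists_seq` depends on the number of points. -/
theorem exists_finset_range_of_mem_convexHull {E : Type*} [AddCommGroup E] [Module ℝ E]
    {p : ℕ → E} {v : E} (hv : v ∈ convexHull ℝ (Set.range p)) :
    ∃ M, v ∈ convexHull ℝ (p '' Set.Iio M) := by
  have hU : Set.range p = ⋃ M : ℕ, p '' Set.Iio M := by
    ext x
    simp only [Set.mem_range, Set.mem_iUnion, Set.mem_image, Set.mem_Iio]
    exact ⟨fun ⟨n, hn⟩ => ⟨n + 1, n, n.lt_succ_self, hn⟩, fun ⟨_, n, _, hn⟩ => ⟨n, hn⟩⟩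
  have hmono : Monotone fun M : ℕ => p '' Set.Iio M := fun a b hab =>
    Set.image_mono (Set.Iio_subset_Iio hab)
  have hconv : Convex ℝ (⋃ M : ℕ, convexHull ℝ (p '' Set.Iio M)) :=
    Directed.convex_iUnion
      (Monotone.directed_le fun a b hab => convexHull_mono (hmono hab))
      fun _ => convex_convexHull ℝ _
  have hsub : convexHull ℝ (Set.range p) ⊆ ⋃ M : ℕ, convexHull ℝ (p '' Set.Iio M) := by
    refine convexHull_min ?_ hconv
    rw [hU]
    exact Set.iUnion_mono fun M => subset_convexHull ℝ _
  exact Set.mem_iUnion.1 (hsub hv)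

/-- One almost maximal `c` in `B` serves all `x`, since the supremum over the sum is at most `r`
plus the supremum over `B`. -/
theorem exists_mem_slice_add {E : Type*} [NormedAddCommGroup E] [NormedSpace ℝ E]
    {A B : Set E} (f : E →L[ℝ] ℝ) {r : ℝ} (hA : ∀ c ∈ A, f c ≤ r) (hB0 : B.Nonempty)
    (hB : ∀ c ∈ B, ‖c‖ ≤ 3 / 2) {ε : ℝ} (hε : 0 < ε) :
    ∃ c ∈ B, ∀ x ∈ A, r - ε / 2 < f x → x + c ∈ sliceSet (A + B) f ε := by
  have hbdd : BddAbove (f '' B) := by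
    refine ⟨‖f‖ * (3 / 2), ?_⟩
    rintro _ ⟨c, hc, rfl⟩
    exact (le_abs_self _).trans ((f.le_opNorm c).trans (by gcongr; exact hB c hc))
  obtain ⟨_, ⟨c, hc, rfl⟩, hfc⟩ := exists_lt_of_lt_csSup (hB0.image f)
    (show sSup (f '' B) - ε / 2 < sSup (f '' B) by linarith)
  refine ⟨c, hc, fun x hx hfx => ⟨Set.add_mem_add hx hc, ?_⟩⟩
  have : sSup (f '' (A + B)) ≤ r + sSup (f '' B) := by
    refine csSup_le ⟨_, Set.mem_image_of_mem f (Set.add_mem_add hx hc)⟩ ?_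
    rintro _ ⟨_, ⟨a, ha, b, hb, rfl⟩, rfl⟩
    simp only [map_add]
    exact add_le_add (hA a ha) (le_csSup hbdd (Set.mem_image_of_mem f hb))
  rw [map_add]
  linarith

theorem DaugavetSlices.exists_not_mem_closure [Nontrivial Z] (hZ : DaugavetSlices Z)
    {C₁ C₂ : Set (Z × ℝ)} (hb₁ : Metric.closedBall 0 1 ⊆ C₁) (hb₂ : Metric.closedBall 0 1 ⊆ C₂)
    (hn₁ : ∀ c ∈ C₁, ‖c‖ ≤ 3 / 2) (hn₂ : ∀ c ∈ C₂, ‖c‖ ≤ 3 / 2)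
    (hor : ∀ f : Z × ℝ →L[ℝ] ℝ,
      (∀ c ∈ C₁, f c ≤ ‖f.comp (ContinuousLinearMap.inl ℝ Z ℝ)‖ + |f (0, 1)|) ∨
      (∀ c ∈ C₂, f c ≤ ‖f.comp (ContinuousLinearMap.inl ℝ Z ℝ)‖ + |f (0, 1)|)) :
    ∃ q ∈ C₁ + C₂, ∀ (f : ℕ → Z × ℝ →L[ℝ] ℝ) (ε : ℕ → ℝ), (∀ n, 0 < ε n) →
      ∃ p : ℕ → Z × ℝ, (∀ n, p n ∈ sliceSet (C₁ + C₂) (f n) (ε n)) ∧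
        q ∉ closure (convexHull ℝ (Set.range p)) := by
  obtain ⟨y, hy⟩ := exists_norm_eq Z zero_le_one
  have hyb : (y, (0 : ℝ)) ∈ Metric.closedBall (0 : Z × ℝ) 1 := by
    simp [Prod.norm_def, hy]
  have h0b : (0 : Z × ℝ) ∈ Metric.closedBall (0 : Z × ℝ) 1 := by simp
  refine ⟨_, Set.add_mem_add (hb₁ hyb) (hb₂ hyb), fun f ε hε => ?_⟩
  have hc : ∀ n, ∃ c : Z × ℝ, ‖c‖ ≤ 3 / 2 ∧ ∀ x ∈ Metric.closedBall (0 : Z × ℝ) 1,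
      ‖(f n).comp (ContinuousLinearMap.inl ℝ Z ℝ)‖ + |f n (0, 1)| - ε n / 2 < f n x →
      x + c ∈ sliceSet (C₁ + C₂) (f n) (ε n) := by
    intro n
    rcases hor (f n) with h | h
    · obtain ⟨c, hc, hx⟩ := exists_mem_slice_add (f n) h ⟨0, hb₂ h0b⟩ hn₂ (hε n)
      exact ⟨c, hn₂ c hc, fun x hxb => hx x (hb₁ hxb)⟩
    · obtain ⟨c, hc, hx⟩ := exists_mem_slice_add (f n) h ⟨0, hb₁ h0b⟩ hn₁ (hε n)
      refine ⟨c, hn₁ c hc, fun x hxb => ?_⟩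
      rw [add_comm C₁ C₂]
      exact hx x (hb₂ hxb)
  choose c hcn hcx using hc
  obtain ⟨b, hb, hbh, hφ⟩ := hZ.exists_seq y
    (fun n => (f n).comp (ContinuousLinearMap.inl ℝ Z ℝ)) (fun n => ε n / 2)
    (fun n => half_pos (hε n)) (η := 1 / 4) (by norm_num)
  obtain ⟨s, hs1, hs⟩ : ∃ s : ℕ → ℝ, (∀ n, |s n| ≤ 1) ∧ ∀ n, s n * f n (0, 1) = |f n (0, 1)| := by
    refine ⟨fun n => SignType.sign (f n (0, 1)), fun n => ?_, fun n => sign_mul_self _⟩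
    rcases lt_trichotomy (f n (0, 1)) 0 with h | h | h <;> simp [h]
  refine ⟨fun n => (b n, s n) + c n, fun n => hcx n _ ?_ ?_, fun hq => ?_⟩
  · rw [mem_closedBall_zero_iff, Prod.norm_def]
    exact max_le (hb n) (hs1 n)
  · rw [clm_prod_apply (f n) (b n) (s n), hs]
    linarith [hbh n]
  obtain ⟨v, hv, hqv⟩ := Metric.mem_closure_iff.1 hq (1 / 4) (by norm_num)
  obtain ⟨M, hM⟩ := exists_finset_range_of_mem_convexHull hv
  obtain ⟨φ, hφ1, hφy, hφb⟩ := hφ M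
  let Φ : Z × ℝ →L[ℝ] ℝ := φ.comp (ContinuousLinearMap.fst ℝ Z ℝ)
  have hΦ : ∀ x, Φ x = φ x.1 := fun x => rfl
  have hΦn : ∀ x, Φ x ≤ ‖x‖ := fun x =>
    (apply_le_norm_of_opNorm_le_one hφ1 _).trans (le_max_left _ _)
  -- The bound is -1 + 1/4 + 3/2. At 2(y, 0) the value is at least 2(1 - 1/4) = 3/2, too far for an
  -- approximation within 1/4.
  have hv' : Φ v ≤ 3 / 4 := by
    have hcv : Convex ℝ {x : Z × ℝ | Φ x ≤ 3 / 4} := convex_halfSpace_le Φ.isLinear _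
    refine convexHull_min (t := {x : Z × ℝ | Φ x ≤ 3 / 4}) ?_ hcv hM
    rintro _ ⟨i, hi, rfl⟩
    have h1 := hφb i hi
    have h2 := (hΦn (c i)).trans (hcn i)
    change Φ ((b i, s i) + c i) ≤ 3 / 4
    rw [map_add]
    have h3 : Φ (b i, s i) = φ (b i) := rfl
    linarith
  have h1 := hΦn ((y, (0 : ℝ)) + (y, 0) - v)
  rw [dist_eq_norm] at hqv
  rw [map_sub, map_add] at h1
  have h2 : Φ (y, (0 : ℝ)) = φ y := rfl
  linarith

end Sum

/-! ### Transfer along embeddings. -/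

section Transfer

variable {W Y : Type*} [NormedAddCommGroup W] [NormedSpace ℝ W] [NormedAddCommGroup Y]
  [NormedSpace ℝ Y]

theorem sliceSet_image (J : W →L[ℝ] Y) (C : Set W) (F : Y →L[ℝ] ℝ) (ε : ℝ) :
    sliceSet (J '' C) F ε = J '' sliceSet C (F.comp J) ε := by
  have h : F '' (J '' C) = (F.comp J) '' C := by rw [Set.image_image]; rfl
  ext y
  constructor
  · rintro ⟨⟨c, hc, rfl⟩, hy⟩
    exact ⟨c, ⟨hc, by rwa [h] at hy⟩, rfl⟩
  · rintro ⟨c, ⟨hc, hc'⟩, rfl⟩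
    exact ⟨⟨c, hc, rfl⟩, by rwa [h]⟩

theorem image_convexHull_clm (J : W →L[ℝ] Y) (B : Set W) :
    J '' convexHull ℝ B = convexHull ℝ (J '' B) :=
  J.toLinearMap.image_convexHull B

theorem IsSCD.image {C : Set W} (hC : IsSCD C) (J : W →L[ℝ] Y)
    (hext : ∀ f : W →L[ℝ] ℝ, ∃ F : Y →L[ℝ] ℝ, F.comp J = f) : IsSCD (J '' C) := by
  obtain ⟨hb, U, hU, hdet⟩ := hC
  refine ⟨?_, fun n => J '' U n, fun n => ?_,
    fun n => ⟨(hdet.1 n).1.image J, Set.image_mono (hdet.1 n).2⟩, fun B hB => ?_⟩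
  · exact J.lipschitz.isBounded_image hb
  · obtain ⟨hne, f, hf, ε, hε, hUn⟩ := hU n
    obtain ⟨F, rfl⟩ := hext f
    refine ⟨hne.image J, F, ?_, ε, hε, ?_⟩
    · rintro rfl
      exact hf (ContinuousLinearMap.zero_comp J)
    · rw [sliceSet_image, ← hUn]
  · have h := hdet.2 (J ⁻¹' B) fun n => by
      obtain ⟨_, hyB, c, hc, rfl⟩ := hB n
      exact ⟨c, hyB, hc⟩
    refine (Set.image_mono h).trans ((image_closure_subset_closure_image J.continuous).trans ?_)
    rw [image_convexHull_clm]
    exact closure_mono (convexHull_mono (Set.image_preimage_subset _ _))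

/-- Slices of the image pull back to slices given by `F ∘ J`. This composition may vanish, so `hC`
admits zero functionals. -/
theorem not_isSCD_image {C : Set W} {J : W →L[ℝ] Y} (hJ : Topology.IsClosedEmbedding J) {q : W}
    (hq : q ∈ C)
    (hC : ∀ (f : ℕ → W →L[ℝ] ℝ) (ε : ℕ → ℝ), (∀ n, 0 < ε n) →
      ∃ p : ℕ → W, (∀ n, p n ∈ sliceSet C (f n) (ε n)) ∧
        q ∉ closure (convexHull ℝ (Set.range p))) : ¬ IsSCD (J '' C) := by
  rintro ⟨-, U, hU, hdet⟩
  choose hne F hF ε hε hUF using hU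
  obtain ⟨p, hp, hqp⟩ := hC (fun n => (F n).comp J) ε hε
  have h := hdet.2 (J '' Set.range p) (fun n => ⟨J (p n), ⟨_, ⟨n, rfl⟩, rfl⟩, by
    rw [hUF, sliceSet_image]; exact ⟨_, hp n, rfl⟩⟩) ⟨q, hq, rfl⟩
  rw [← image_convexHull_clm, hJ.closure_image_eq] at h
  obtain ⟨q', hq', hqq'⟩ := h
  exact hqp (hJ.injective hqq' ▸ hq')

end Transfer

/-! ### Assembly in Y. -/

section Main

variable {Y Z : Type*} [NormedAddCommGroup Y] [NormedSpace ℝ Y]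
  [NormedAddCommGroup Z] [NormedSpace ℝ Z]

theorem exists_extension_linearIsometry (ι : Z →ₗᵢ[ℝ] Y) (h : Z →L[ℝ] ℝ) :
    ∃ H : Y →L[ℝ] ℝ, ∀ z, H (ι z) = h z := by
  obtain ⟨H, hH, -⟩ := exists_extension_norm_eq (LinearMap.range ι.toLinearMap)
    (h.comp (ι.equivRange.symm.toContinuousLinearEquiv : _ →L[ℝ] Z))
  refine ⟨H, fun z => ?_⟩
  have := hH (ι.equivRange z)
  simpa using this

/-- The existence of the two sets, in the form in which it is transported from `Z × ℝ`. -/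
theorem DaugavetSlices.exists_isSCD_add_not_isSCD [CompleteSpace Z] [Nontrivial Z]
    [TopologicalSpace.SeparableSpace Z] (hZ : DaugavetSlices Z) (ι : Z →ₗᵢ[ℝ] Y)
    (g : Y →L[ℝ] ℝ) {e : Y} (he : g e = 1) (hι : ∀ z, g (ι z) = 0) :
    ∃ C₁ C₂ : Set Y,
      (Convex ℝ C₁ ∧ IsClosed C₁ ∧ Bornology.IsBounded C₁ ∧ -C₁ = C₁ ∧ IsSCD C₁) ∧
      (Convex ℝ C₂ ∧ IsClosed C₂ ∧ Bornology.IsBounded C₂ ∧ -C₂ = C₂ ∧ IsSCD C₂) ∧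
      ((∀ y, g y = 0 → ∃ z, ι z = y) → (interior C₁).Nonempty ∧ (interior C₂).Nonempty) ∧
      ¬ IsSCD (C₁ + C₂) := by
  obtain ⟨C₁, hconv₁, hcl₁, hneg₁, hscd₁, hball₁, hn₁, hle₁⟩ :=
    curveData_steep.exists_isSCD (Z := Z)
  obtain ⟨C₂, hconv₂, hcl₂, hneg₂, hscd₂, hball₂, hn₂, hle₂⟩ :=
    curveData_flat.exists_isSCD (Z := Z)
  have hor : ∀ f : Z × ℝ →L[ℝ] ℝ,
      (∀ c ∈ C₁, f c ≤ ‖f.comp (ContinuousLinearMap.inl ℝ Z ℝ)‖ + |f (0, 1)|) ∨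
      (∀ c ∈ C₂, f c ≤ ‖f.comp (ContinuousLinearMap.inl ℝ Z ℝ)‖ + |f (0, 1)|) := by
    intro f
    -- With A = ‖h‖, S = |f (0, 1)| and x = 4^{-(j+1)}, the steep curve gives A + S + x(S - A) -
    -- x²A; the flat one exchanges A and S.
    rcases le_total |f (0, 1)| ‖f.comp (ContinuousLinearMap.inl ℝ Z ℝ)‖ with h | h
    · left
      refine hle₁ f _ fun j => ?_
      have hx : (0 : ℝ) < (1 / 4) ^ (j + 1) := by positivity
      have h1 := mul_le_mul_of_nonneg_left h hx.le
      have h2 : 0 ≤ ((1 / 4 : ℝ) ^ (j + 1)) ^ 2 * ‖f.comp (ContinuousLinearMap.inl ℝ Z ℝ)‖ := by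
        positivity
      linarith
    · right
      refine hle₂ f _ fun j => ?_
      have hx : (0 : ℝ) < (1 / 4) ^ (j + 1) := by positivity
      have h1 := mul_le_mul_of_nonneg_left h hx.le
      have h2 : 0 ≤ ((1 / 4 : ℝ) ^ (j + 1)) ^ 2 * |f (0, 1)| := by positivity
      linarith
  obtain ⟨q, hq, hnot⟩ := hZ.exists_not_mem_closure hball₁ hball₂ hn₁ hn₂ hor
  let J : Z × ℝ →L[ℝ] Y := ι.toContinuousLinearMap.comp (ContinuousLinearMap.fst ℝ Z ℝ) +
    (ContinuousLinearMap.snd ℝ Z ℝ).smulRight e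
  have hJ : ∀ c, J c = ι c.1 + c.2 • e := fun c => rfl
  have hgJ : ∀ c, g (J c) = c.2 := fun c => by
    rw [hJ, map_add, hι, map_smul, he, smul_eq_mul, mul_one, zero_add]
  set R : ℝ := 1 + ‖g‖ * ‖e‖ + ‖g‖ with hR
  have hR0 : 0 < R := by positivity
  have hbound : ∀ c, ‖c‖ ≤ R * ‖J c‖ := by
    intro c
    have h1 : ‖c.2‖ ≤ ‖g‖ * ‖J c‖ := hgJ c ▸ g.le_opNorm (J c)
    have h2 : ‖c.1‖ ≤ ‖J c‖ + ‖c.2‖ * ‖e‖ := by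
      have : ι c.1 = J c - c.2 • e := by rw [hJ, add_sub_cancel_right]
      rw [← ι.norm_map, this, ← norm_smul]
      exact norm_sub_le _ _
    have h3 : ‖c.2‖ * ‖e‖ ≤ ‖g‖ * ‖J c‖ * ‖e‖ := mul_le_mul_of_nonneg_right h1 (norm_nonneg e)
    have h4 : 0 ≤ ‖g‖ * ‖J c‖ := by positivity
    have h5 : 0 ≤ ‖g‖ * ‖J c‖ * ‖e‖ := by positivity
    rw [Prod.norm_def]
    refine max_le ?_ ?_
    · rw [hR]; linarith
    · rw [hR]; linarith [norm_nonneg (J c)]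
  have hemb : Topology.IsClosedEmbedding J :=
    (AddMonoidHomClass.antilipschitz_of_bound J (K := ⟨R, hR0.le⟩) hbound).isClosedEmbedding
      J.uniformContinuous
  have hext : ∀ f : Z × ℝ →L[ℝ] ℝ, ∃ F : Y →L[ℝ] ℝ, F.comp J = f := by
    intro f
    obtain ⟨H, hH⟩ := exists_extension_linearIsometry ι
      (f.comp (ContinuousLinearMap.inl ℝ Z ℝ))
    -- On the range of `J`, `g` recovers the real coordinate and y ↦ y - g(y)e the Z-component.
    refine ⟨H.comp (ContinuousLinearMap.id ℝ Y - g.smulRight e) + f (0, 1) • g, ?_⟩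
    refine ContinuousLinearMap.ext fun c => ?_
    change H (J c - g (J c) • e) + f (0, 1) * g (J c) = f (c.1, c.2)
    rw [hgJ, hJ, add_sub_cancel_right, hH, clm_prod_apply f c.1 c.2, mul_comm]
  have hset : ∀ C : Set (Z × ℝ), Convex ℝ C → IsClosed C → -C = C → IsSCD C →
      Convex ℝ (J '' C) ∧ IsClosed (J '' C) ∧ Bornology.IsBounded (J '' C) ∧
        -(J '' C) = J '' C ∧ IsSCD (J '' C) := by
    intro C h1 h2 h3 h4
    refine ⟨h1.linear_image J.toLinearMap, hemb.isClosedMap C h2, (h4.image J hext).1, ?_,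
      h4.image J hext⟩
    conv_rhs => rw [← h3, ← Set.image_neg_eq_neg, Set.image_image]
    rw [← Set.image_neg_eq_neg, Set.image_image]
    simp only [map_neg]
  have hint : ∀ C : Set (Z × ℝ), Metric.closedBall 0 1 ⊆ C → (∀ y, g y = 0 → ∃ z, ι z = y) →
      (interior (J '' C)).Nonempty := by
    intro C hC hsurj
    refine ⟨0, mem_interior_iff_mem_nhds.2 (Filter.mem_of_superset
      (Metric.ball_mem_nhds 0 (inv_pos.2 hR0)) fun y hy => ?_)⟩
    obtain ⟨z, hz⟩ := hsurj (y - g y • e) (by rw [map_sub, map_smul, he]; simp)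
    have hy' : J (z, g y) = y := by rw [hJ, hz]; simp
    refine ⟨(z, g y), hC ?_, hy'⟩
    rw [mem_closedBall_zero_iff]
    refine (hbound _).trans ?_
    rw [hy']
    rw [mem_ball_zero_iff] at hy
    calc R * ‖y‖ ≤ R * R⁻¹ := by gcongr
      _ = 1 := mul_inv_cancel₀ hR0.ne'
  refine ⟨J '' C₁, J '' C₂, hset C₁ hconv₁ hcl₁ hneg₁ hscd₁, hset C₂ hconv₂ hcl₂ hneg₂ hscd₂,
    fun h => ⟨hint C₁ hball₁ h, hint C₂ hball₂ h⟩, ?_⟩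
  rw [← Set.image_add]
  exact not_isSCD_image hemb hq hnot

end Main

end BanachSCD

theorem mainTheorem7 {Y : Type*} [NormedAddCommGroup Y] [NormedSpace ℝ Y] [CompleteSpace Y]
    [Nontrivial Y] (hY : BanachSCD.DaugavetProperty Y) :
    ∃ C₁ C₂ : Set Y,
      (Convex ℝ C₁ ∧ IsClosed C₁ ∧ Bornology.IsBounded C₁ ∧ -C₁ = C₁ ∧ BanachSCD.IsSCD C₁) ∧
      (Convex ℝ C₂ ∧ IsClosed C₂ ∧ Bornology.IsBounded C₂ ∧ -C₂ = C₂ ∧ BanachSCD.IsSCD C₂) ∧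
      (TopologicalSpace.SeparableSpace Y →
        (interior C₁).Nonempty ∧ (interior C₂).Nonempty) ∧
      ¬ BanachSCD.IsSCD (C₁ + C₂) := by
  have hD := hY.daugavetSlices
  obtain ⟨e, he⟩ := exists_norm_eq Y zero_le_one
  obtain ⟨g, hg, hge⟩ := exists_dual_vector' ℝ e
  replace hge : g e = 1 := by rw [hge, he]; rfl
  have hK := hD.ker g hge
  have := hD.nontrivial_ker g hg hge he
  have hKc : IsClosed (LinearMap.ker (g : Y →ₗ[ℝ] ℝ) : Set Y) := g.isClosed_ker
  have : CompleteSpace (LinearMap.ker (g : Y →ₗ[ℝ] ℝ)) := hKc.completeSpace_coe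
  -- Only the whole kernel makes `J` surjective, which yields interior points; without separability
  -- none are required.
  by_cases hsep : TopologicalSpace.SeparableSpace Y
  · have : SecondCountableTopology Y := UniformSpace.secondCountable_of_separable Y
    obtain ⟨C₁, C₂, h₁, h₂, hint, hsum⟩ := hK.exists_isSCD_add_not_isSCD
      (LinearMap.ker (g : Y →ₗ[ℝ] ℝ)).subtypeₗᵢ g hge fun z => z.2
    exact ⟨C₁, C₂, h₁, h₂, fun _ => hint fun y hy => ⟨⟨y, hy⟩, rfl⟩, hsum⟩
  · obtain ⟨Z, hZc, hZs, hZn, hZ⟩ := hK.exists_separable_subspace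
    have : CompleteSpace Z := hZc.completeSpace_coe
    obtain ⟨C₁, C₂, h₁, h₂, -, hsum⟩ := hZ.exists_isSCD_add_not_isSCD
      ((LinearMap.ker (g : Y →ₗ[ℝ] ℝ)).subtypeₗᵢ.comp Z.subtypeₗᵢ) g hge fun z => z.1.2
    exact ⟨C₁, C₂, h₁, h₂, fun h => absurd h hsep, hsum⟩
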